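/- Let $(M,g_1)$ be a Riemannian manifold and let $(N,g_2,J)$ be a Kähler manifold: $J$ is a smooth $(1,1)$-tensor field with $J^2=-I$, $g_2(J\cdot,J\cdot)=g_2$ and $\nabla^N J=0$, where $\nabla^N$ is the Levi-Civita connection. Let $F:M\to N$ be a Riemannian map, i.e. a smooth map such that $F_{*p}$ is isometric on $(\ker F_{*p})^\perp$ for every $p\in M$. Assume: 1. (*Lagrangian*) For every $p\in M$, $J(\operatorname{range}F_{*p})\subseteq(\operatorname{range}F_{*p})^\perp$, and the orthogonal complement of $J(\operatorname{range}F_{*p})$ in $(\operatorname{range}F_{*p})^\perp$ is $0$. 2. $\dim(\operatorname{range}F_{*p})>1$ for every $p\in M$. 3. $\operatorname{range}F_*$ is a distribution on the base: there are an open set $W\subseteq N$ containing $F(M)$ (for example $W=N$) and a smooth distribution $D$ on $W$ with $D_{F(p)}=\operatorname{range}F_{*p}$ for all $p\in M$. Moreover $D^\perp$ (that is, $(\operatorname{range}F_*)^\perp$) is totally geodesic: $\nabla^N_UV$ is a section of $D^\perp$ for all local smooth sections $U,V$ of $D^\perp$. 4. (*Clairaut with $\tilde s=e^g$*) $g:N\to\mathbb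 R$ is a smooth function such that for every geodesic $\beta$ of $N$ lying in $W$ the function $t\mapsto e^{g(\beta(t))}\sin\omega(t)$ is constant, where $\omega(t)$ is the angle between $\dot\beta(t)$ and its component $V(t)\in D^\perp$ (with $\omega(t)=\pi/2$ if $V(t)=0$). Let $\nabla^F$ denote the pullback of $\nabla^N$ along $F$. Then: (i) $\operatorname{range}F_*$ is minimal: for every $p\in M$ its mean curvature vector $$H_2(p)=\frac1{\dim(\operatorname{range}F_{*p})}\sum_j\bigl(\nabla^F_{X_j}F_*X_j\bigr)^{\perp}(p)$$ vanishes, where $\{X_j(p)\}$ is an orthonormal basis of $(\ker F_{*p})^\perp$, extended to smooth vector fields near $p$, and $(\cdot)^\perp$ is the component in $(\operatorname{range}F_{*p})^\perp$. (ii) $\operatorname{range}F_*$ is totally geodesic: $\nabla^F_X(F_*Y)$ is a section of $\operatorname{range}F_*$ for all smooth local vector fields $X,Y$ on $M$. -/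

import Mathlib

open Bundle FiberBundle VectorField Module Set
open scoped Manifold ContDiff Topology

noncomputable section LeviCivita

variable {E : Type*} [NormedAddCommGroup E] [NormedSpace ℝ E] [FiniteDimensional ℝ E]
  {H : Type*} [TopologicalSpace H] {I : ModelWithCorners ℝ E H}
  {M : Type*} [TopologicalSpace M] [ChartedSpace H M] [IsManifold I ∞ M]
  [RiemannianBundle (fun x : M ↦ TangentSpace I x)]
  [IsContMDiffRiemannianBundle I ∞ E (fun x : M ↦ TangentSpace I x)]

theorem mdiffAt_inner {x : M} {V W : Π x : M, TangentSpace I x}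
    (hV : MDiffAt (T% V) x) (hW : MDiffAt (T% W) x) :
    MDiffAt (fun y ↦ inner ℝ (V y) (W y)) x :=
  MDifferentiableAt.inner_bundle (F := E) (E := fun x : M ↦ TangentSpace I x) hV hW

/-- The right-hand side of the Koszul formula. -/
def koszul (Y X Z : Π x : M, TangentSpace I x) (x : M) : ℝ :=
  (1 / 2 : ℝ) *
    (mvfderiv I (fun y ↦ inner ℝ (Y y) (Z y)) x (X x)
      + mvfderiv I (fun y ↦ inner ℝ (X y) (Z y)) x (Y x)
      - mvfderiv I (fun y ↦ inner ℝ (X y) (Y y)) x (Z x)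
      + inner ℝ (mlieBracket I X Y x) (Z x)
      - inner ℝ (mlieBracket I X Z x) (Y x)
      - inner ℝ (mlieBracket I Y Z x) (X x))

theorem koszul_tensorial_left {x : M} {Y Z : Π x : M, TangentSpace I x}
    (hY : MDiffAt (T% Y) x) (hZ : MDiffAt (T% Z) x) :
    TensorialAt I E (fun X ↦ koszul Y X Z x) x where
  smul {f X} hf hX := by
    have e1 := mvfderiv_fun_mul hf (mdiffAt_inner hX hZ)
    have e2 := mvfderiv_fun_mul hf (mdiffAt_inner hX hY)
    simp only [koszul, Pi.smul_apply', inner_smul_left, mlieBracket_smul_left hf hX,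
      inner_add_left, conj_trivial, e1, e2, inner_smul_right, map_smul, smul_eq_mul]
    simp [real_inner_comm]
    ring
  add {X X'} hX hX' := by
    have e1 := mvfderiv_fun_add (mdiffAt_inner hX hZ) (mdiffAt_inner hX' hZ)
    have e2 := mvfderiv_fun_add (mdiffAt_inner hX hY) (mdiffAt_inner hX' hY)
    simp only [koszul, Pi.add_apply, inner_add_left, mlieBracket_add_left hX hX',
      e1, e2, inner_add_right, map_add]
    simp
    ring

theorem koszul_tensorial_right {x : M} {Y X : Π x : M, TangentSpace I x}
    (hY : MDiffAt (T% Y) x) (hX : MDiffAt (T% X) x) :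
    TensorialAt I E (fun Z ↦ koszul Y X Z x) x where
  smul {f Z} hf hZ := by
    have e1 := mvfderiv_fun_mul hf (mdiffAt_inner hX hZ)
    have e2 := mvfderiv_fun_mul hf (mdiffAt_inner hY hZ)
    simp only [koszul, Pi.smul_apply', inner_smul_right, mlieBracket_smul_right hf hZ,
      inner_add_left, conj_trivial, e1, e2, inner_smul_left, map_smul, smul_eq_mul]
    simp [real_inner_comm]
    ring
  add {Z Z'} hZ hZ' := by
    have e1 := mvfderiv_fun_add (mdiffAt_inner hX hZ) (mdiffAt_inner hX hZ')
    have e2 := mvfderiv_fun_add (mdiffAt_inner hY hZ) (mdiffAt_inner hY hZ')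
    simp only [koszul, Pi.add_apply, inner_add_left, mlieBracket_add_right hZ hZ',
      e1, e2, inner_add_right, map_add]
    simp
    ring

theorem koszul_add {x : M} {Y Y' X Z : Π x : M, TangentSpace I x}
    (hY : MDiffAt (T% Y) x) (hY' : MDiffAt (T% Y') x)
    (hX : MDiffAt (T% X) x) (hZ : MDiffAt (T% Z) x) :
    koszul (Y + Y') X Z x = koszul Y X Z x + koszul Y' X Z x := by
  have e1 := mvfderiv_fun_add (mdiffAt_inner hY hZ) (mdiffAt_inner hY' hZ)
  have e2 := mvfderiv_fun_add (mdiffAt_inner hX hY) (mdiffAt_inner hX hY')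
  simp only [koszul, Pi.add_apply, inner_add_left, mlieBracket_add_left hY hY',
    mlieBracket_add_right hY hY', e1, e2, inner_add_right, map_add]
  simp
  ring

theorem koszul_smul {x : M} {Y X Z : Π x : M, TangentSpace I x} {f : M → ℝ}
    (hf : MDiffAt f x) (hY : MDiffAt (T% Y) x)
    (hX : MDiffAt (T% X) x) (hZ : MDiffAt (T% Z) x) :
    koszul (f • Y) X Z x =
      f x * koszul Y X Z x + mvfderiv I f x (X x) * inner ℝ (Y x) (Z x) := by
  have e1 := mvfderiv_fun_mul hf (mdiffAt_inner hY hZ)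
  have e2 := mvfderiv_fun_mul hf (mdiffAt_inner hX hY)
  simp only [koszul, Pi.smul_apply', inner_smul_left, mlieBracket_smul_left hf hY,
    mlieBracket_smul_right hf hY, inner_add_left, conj_trivial, e1, e2, inner_smul_right,
    map_smul, smul_eq_mul]
  simp [real_inner_comm]
  ring

/-- The Levi-Civita derivative of the vector field `Y` at `x`: the vector `∇_v Y` is determined by
the Koszul formula. As a convention it is `0` at points where `Y` is not differentiable. -/
def leviCivitaFun (Y : Π x : M, TangentSpace I x) (x : M) :
    TangentSpace I x →L[ℝ] TangentSpace I x :=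
  open Classical in
  haveI : FiniteDimensional ℝ (TangentSpace I x) := inferInstanceAs (FiniteDimensional ℝ E)
  if hY : MDiffAt (T% Y) x then
    LinearMap.toContinuousLinearMap
      { toFun := fun v ↦ (InnerProductSpace.toDual ℝ (TangentSpace I x)).symm
          (TensorialAt.mkHom₂ (I := I) (F := E) (F' := E) (fun X Z ↦ koszul Y X Z x) x
            (fun _ hZ ↦ koszul_tensorial_left hY hZ)
            (fun _ hX ↦ koszul_tensorial_right hY hX) v)
        map_add' := fun v w ↦ by rw [map_add, map_add]
        map_smul' := fun c v ↦ by rw [map_smul, LinearIsometryEquiv.map_smulₛₗ]; simp }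
  else 0

theorem inner_leviCivitaFun {x : M} {Y X Z : Π x : M, TangentSpace I x}
    (hY : MDiffAt (T% Y) x) (hX : MDiffAt (T% X) x) (hZ : MDiffAt (T% Z) x) :
    inner ℝ (leviCivitaFun Y x (X x)) (Z x) = koszul Y X Z x := by
  have : FiniteDimensional ℝ (TangentSpace I x) := inferInstanceAs (FiniteDimensional ℝ E)
  rw [leviCivitaFun, dif_pos hY, LinearMap.coe_toContinuousLinearMap', LinearMap.coe_mk,
    AddHom.coe_mk, InnerProductSpace.toDual_symm_apply]
  exact TensorialAt.mkHom₂_apply _ _ hX hZ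

theorem ext_leviCivita {x : M} {A B : TangentSpace I x →L[ℝ] TangentSpace I x}
    (h : ∀ X Z : Π x : M, TangentSpace I x, MDiffAt (T% X) x → MDiffAt (T% Z) x →
      inner ℝ (A (X x)) (Z x) = inner ℝ (B (X x)) (Z x)) : A = B := by
  ext v
  refine ext_inner_right ℝ fun w ↦ ?_
  simpa using h (extend E v) (extend E w) (mdifferentiableAt_extend ..)
    (mdifferentiableAt_extend ..)

variable (I M) in
/-- The Levi-Civita connection of a Riemannian manifold. -/
def leviCivita : CovariantDerivative I E (TangentSpace I : M → Type _) where
  toFun := leviCivitaFun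
  isCovariantDerivativeOnUniv :=
    { add := fun {Y Y' x} hY hY' _ ↦ by
        refine ext_leviCivita fun X Z hX hZ ↦ ?_
        rw [inner_leviCivitaFun (mdifferentiableAt_add_section hY hY') hX hZ,
          koszul_add hY hY' hX hZ, add_apply, inner_add_left,
          inner_leviCivitaFun hY hX hZ, inner_leviCivitaFun hY' hX hZ]
      leibniz := fun {Y f x} hY hf _ ↦ by
        refine ext_leviCivita fun X Z hX hZ ↦ ?_
        rw [inner_leviCivitaFun (hf.smul_section hY) hX hZ, koszul_smul hf hY hX hZ]
        simp [inner_add_left, inner_smul_left, inner_leviCivitaFun hY hX hZ] }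

theorem inner_leviCivita {x : M} {Y X Z : Π x : M, TangentSpace I x}
    (hY : MDiffAt (T% Y) x) (hX : MDiffAt (T% X) x) (hZ : MDiffAt (T% Z) x) :
    inner ℝ (leviCivita I M Y x (X x)) (Z x) = koszul Y X Z x :=
  inner_leviCivitaFun hY hX hZ

theorem leviCivita_torsion {x : M} {X Y : Π x : M, TangentSpace I x}
    (hX : MDiffAt (T% X) x) (hY : MDiffAt (T% Y) x) :
    leviCivita I M Y x (X x) - leviCivita I M X x (Y x) = mlieBracket I X Y x := by
  refine ext_inner_right ℝ fun w ↦ ?_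
  have hZ : MDiffAt (T% (extend E w)) x := mdifferentiableAt_extend ..
  have h1 := inner_leviCivita hY hX hZ
  have h2 := inner_leviCivita hX hY hZ
  simp only [extend_apply_self] at h1 h2
  rw [inner_sub_left, h1, h2]
  simp only [koszul, extend_apply_self, mlieBracket_swap_apply (V := Y) (W := X), inner_neg_left]
  simp only [real_inner_comm]
  ring

theorem leviCivita_metric {x : M} {X Y Z : Π x : M, TangentSpace I x}
    (hX : MDiffAt (T% X) x) (hY : MDiffAt (T% Y) x) (hZ : MDiffAt (T% Z) x) :
    mvfderiv I (fun y ↦ inner ℝ (Y y) (Z y)) x (X x) =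
      inner ℝ (leviCivita I M Y x (X x)) (Z x) + inner ℝ (Y x) (leviCivita I M Z x (X x)) := by
  rw [real_inner_comm _ (Y x), inner_leviCivita hY hX hZ, inner_leviCivita hZ hX hY]
  simp only [koszul, mlieBracket_swap_apply (V := Z) (W := Y), inner_neg_left]
  simp only [real_inner_comm]
  ring

end LeviCivita

noncomputable section RiemannianMaps

variable {E : Type*} [NormedAddCommGroup E] [NormedSpace ℝ E] [FiniteDimensional ℝ E]
  {H : Type*} [TopologicalSpace H] {I : ModelWithCorners ℝ E H}
  {M : Type*} [TopologicalSpace M] [ChartedSpace H M] [IsManifold I ∞ M]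
  {E' : Type*} [NormedAddCommGroup E'] [NormedSpace ℝ E'] [FiniteDimensional ℝ E']
  {H' : Type*} [TopologicalSpace H'] {I' : ModelWithCorners ℝ E' H'}
  {N : Type*} [TopologicalSpace N] [ChartedSpace H' N] [IsManifold I' ∞ N]
  [RiemannianBundle (fun y : N ↦ TangentSpace I' y)]
  [IsContMDiffRiemannianBundle I' ∞ E' (fun y : N ↦ TangentSpace I' y)]

instance tangentSpace_finiteDimensional (x : M) : FiniteDimensional ℝ (TangentSpace I x) :=
  inferInstanceAs (FiniteDimensional ℝ E)

variable (I I') in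
/-- The pullback `∇^F` of the Levi-Civita connection of `N` along `F : M → N`, applied to a section
`σ` of `F⁻¹TN` and a tangent vector `v` at `p`. If `e_i` is the coordinate frame of `TN` near `F p`
and `σ = ∑ σ^i (e_i ∘ F)`, this is `∑ dσ^i(v) e_i + ∑ σ^i(p) ∇_{F_* v} e_i`; the vector field
`extend E' (σ p)` is `∑ σ^i(p) e_i`. -/
def pullbackCov (F : M → N) (σ : Π p : M, TangentSpace I' (F p)) (p : M)
    (v : TangentSpace I p) : TangentSpace I' (F p) :=
  (trivializationAt E' (TangentSpace I' : N → Type _) (F p)).symmL ℝ (F p)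
      (mvfderiv I (fun q ↦
        (trivializationAt E' (TangentSpace I' : N → Type _) (F p) ⟨F q, σ q⟩).2) p v)
    + leviCivita I' N (extend E' (σ p)) (F p) (mfderiv I I' F p v)

variable (I') in
/-- The velocity vector of a curve. -/
def velocity (β : ℝ → N) (t : ℝ) : TangentSpace I' (β t) :=
  mfderiv 𝓘(ℝ, ℝ) I' β t (1 : ℝ)

variable (I') in
/-- `β` is a geodesic on the open interval `J`: it is smooth and `∇_{β'} β' = 0`. -/
def IsGeodesicOn (β : ℝ → N) (J : Set ℝ) : Prop :=
  ContMDiffOn 𝓘(ℝ, ℝ) I' ∞ β J ∧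
    ∀ t ∈ J, pullbackCov 𝓘(ℝ, ℝ) I' β (velocity I' β) t (1 : ℝ) = 0

/-! ### Distributions on the target -/

/-- `D` is a smooth distribution on the open set `W`: locally it is spanned by a smooth frame. -/
def IsSmoothDistributionOn (D : Π y : N, Submodule ℝ (TangentSpace I' y)) (W : Set N) : Prop :=
  ∀ y ∈ W, ∃ U : Set N, IsOpen U ∧ y ∈ U ∧ U ⊆ W ∧
    ∃ (r : ℕ) (X : Fin r → Π z : N, TangentSpace I' z),
      (∀ i, ContMDiffOn I' I'.tangent ∞ (fun z ↦ (⟨z, X i z⟩ : TangentBundle I' N)) U) ∧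
      ∀ z ∈ U, LinearIndependent ℝ (fun i ↦ X i z) ∧
        Submodule.span ℝ (Set.range fun i ↦ X i z) = D z

/-- The distribution `D` is totally geodesic on the open set `W`: `∇_A B` is a section of `D`
whenever `A` and `B` are smooth local sections of `D`. -/
def IsTotallyGeodesicOn (D : Π y : N, Submodule ℝ (TangentSpace I' y)) (W : Set N) : Prop :=
  ∀ U : Set N, IsOpen U → U ⊆ W → ∀ A B : Π y : N, TangentSpace I' y,
    ContMDiffOn I' I'.tangent ∞ (fun z ↦ (⟨z, A z⟩ : TangentBundle I' N)) U →
    ContMDiffOn I' I'.tangent ∞ (fun z ↦ (⟨z, B z⟩ : TangentBundle I' N)) U →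
    (∀ z ∈ U, A z ∈ D z) → (∀ z ∈ U, B z ∈ D z) →
    ∀ z ∈ U, leviCivita I' N B z (A z) ∈ D z

/-- The angle `ω(t)` between `β'(t)` and its component `V` in `Dᗮ`. When `V = 0` this is `π / 2`. -/
def clairautAngle (D : Π y : N, Submodule ℝ (TangentSpace I' y)) (β : ℝ → N) (t : ℝ) : ℝ :=
  InnerProductGeometry.angle (velocity I' β t) ((D (β t))ᗮ.starProjection (velocity I' β t))

/-- Clairaut's relation for the distribution `D` on `W`, with the positive function `s`: the function
`(s ∘ β) sin ω` is constant along every geodesic `β` in `W`. -/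
def ClairautRelation (D : Π y : N, Submodule ℝ (TangentSpace I' y)) (W : Set N) (s : N → ℝ) :
    Prop :=
  (∀ y, 0 < s y) ∧ ∀ (J : Set ℝ) (β : ℝ → N), IsOpen J → J.OrdConnected → IsGeodesicOn I' β J →
    MapsTo β J W → ∃ c : ℝ, ∀ t ∈ J, s (β t) * Real.sin (clairautAngle D β t) = c

/-! ### Kähler manifolds -/

/-- `(g, J)` is a Kähler structure on the Riemannian manifold `(N, g)`: the smooth tensor field `J`
of type `(1, 1)` satisfies `J² = -1`, is orthogonal, and is parallel. -/
structure IsKahler (J : Π y : N, TangentSpace I' y →L[ℝ] TangentSpace I' y) : Prop where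
  smooth : ContMDiff I' (I'.prod 𝓘(ℝ, E' →L[ℝ] E')) ∞
    (fun y ↦ (TotalSpace.mk' (E' →L[ℝ] E') y (J y) :
      TotalSpace (E' →L[ℝ] E') (fun y : N ↦ TangentSpace I' y →L[ℝ] TangentSpace I' y)))
  sq : ∀ y (v : TangentSpace I' y), J y (J y v) = -v
  orthogonal : ∀ y (v w : TangentSpace I' y), inner ℝ (J y v) (J y w) = inner ℝ v w
  parallel : ∀ (U : Set N), IsOpen U → ∀ Y : Π y : N, TangentSpace I' y,
    ContMDiffOn I' I'.tangent ∞ (fun z ↦ (⟨z, Y z⟩ : TangentBundle I' N)) U →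
    ∀ y ∈ U, ∀ v : TangentSpace I' y,
      leviCivita I' N (fun z ↦ J z (Y z)) y v = J y (leviCivita I' N Y y v)

/-! ### Riemannian maps -/

variable (I I') in
/-- The subspace `range F_{*p}` of `T_{F p} N`. -/
abbrev rangeAt (F : M → N) (p : M) : Submodule ℝ (TangentSpace I' (F p)) :=
  (mfderiv I I' F p).toLinearMap.range

variable (I I') in
/-- `range F_*` is a distribution on `N`: the smooth distribution `D` on the open set `W ⊇ F(M)`
satisfies `D_{F p} = range F_{*p}` for all `p`. -/
structure IsRangeDistribution (F : M → N) (D : Π y : N, Submodule ℝ (TangentSpace I' y))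
    (W : Set N) : Prop where
  isOpen : IsOpen W
  range_subset : Set.range F ⊆ W
  smooth : IsSmoothDistributionOn D W
  eq_rangeAt : ∀ p : M, D (F p) = rangeAt I I' F p

variable (I I') in
/-- `F` is anti-invariant: `J (range F_{*p}) ⊆ (range F_{*p})ᗮ` for every `p`. -/
def IsAntiInvariant (F : M → N) (J : Π y : N, TangentSpace I' y →L[ℝ] TangentSpace I' y) : Prop :=
  ∀ p : M, (rangeAt I I' F p).map (J (F p)).toLinearMap ≤ (rangeAt I I' F p)ᗮ

variable (I I') in
/-- `F` is Lagrangian: it is anti-invariant and the orthogonal complement `μ` of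
`J (range F_*)` in `(range F_*)ᗮ` vanishes. -/
def IsLagrangian (F : M → N) (J : Π y : N, TangentSpace I' y →L[ℝ] TangentSpace I' y) : Prop :=
  IsAntiInvariant I I' F J ∧
    ∀ p : M, ((rangeAt I I' F p).map (J (F p)).toLinearMap)ᗮ ⊓ (rangeAt I I' F p)ᗮ = ⊥

variable (I I') in
/-- `range F_*` is totally geodesic: `∇^F_X (F_* Y)` is again a section of `range F_*`, for all
smooth local vector fields `X`, `Y` on `M`. -/
def IsRangeTotallyGeodesic (F : M → N) : Prop :=
  ∀ U : Set M, IsOpen U → ∀ X Y : Π p : M, TangentSpace I p,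
    ContMDiffOn I I.tangent ∞ (fun q ↦ (⟨q, X q⟩ : TangentBundle I M)) U →
    ContMDiffOn I I.tangent ∞ (fun q ↦ (⟨q, Y q⟩ : TangentBundle I M)) U →
    ∀ p ∈ U, pullbackCov I I' F (fun q ↦ mfderiv I I' F q (Y q)) p (X p) ∈ rangeAt I I' F p

variable (I I') in
/-- The second fundamental form of `range F_*` at `p`: the component of `∇^F_x (F_* Y)` in
`(range F_{*p})ᗮ`, for any vector field `Y` with `Y p = y` (we use the extension of `y` that is
constant in a chart). -/
def rangeSecondFundamentalForm (F : M → N) (p : M) (x y : TangentSpace I p) :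
    TangentSpace I' (F p) :=
  (rangeAt I I' F p)ᗮ.starProjection
    (pullbackCov I I' F (fun q ↦ mfderiv I I' F q (extend E y q)) p x)

variable [RiemannianBundle (fun x : M ↦ TangentSpace I x)]

variable (I I') in
/-- The horizontal space `(ker F_{*p})ᗮ`. -/
abbrev horizontalAt (F : M → N) (p : M) : Submodule ℝ (TangentSpace I p) :=
  ((mfderiv I I' F p).toLinearMap.ker)ᗮ

variable (I I') in
/-- `F` is a Riemannian map: it is smooth and `F_{*p}` is isometric on `(ker F_{*p})ᗮ`. -/
structure IsRiemannianMap (F : M → N) : Prop where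
  smooth : ContMDiff I I' ∞ F
  isometric : ∀ (p : M), ∀ x ∈ horizontalAt I I' F p, ∀ y ∈ horizontalAt I I' F p,
    inner ℝ (mfderiv I I' F p x) (mfderiv I I' F p y) = inner ℝ x y

variable (I I') in
/-- The mean curvature vector `H₂` of `range F_*` at `p`: the trace of the second fundamental form
over an orthonormal basis of `(ker F_{*p})ᗮ`, divided by the dimension of `range F_{*p}`. -/
def rangeMeanCurvature (F : M → N) (p : M) : TangentSpace I' (F p) :=
  (finrank ℝ (rangeAt I I' F p) : ℝ)⁻¹ •
    ∑ j, rangeSecondFundamentalForm I I' F p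
      (stdOrthonormalBasis ℝ (horizontalAt I I' F p) j : TangentSpace I p)
      (stdOrthonormalBasis ℝ (horizontalAt I I' F p) j : TangentSpace I p)

variable (I I') in
/-- `range F_*` is minimal: its mean curvature vector field vanishes. -/
def IsRangeMinimal (F : M → N) : Prop :=
  ∀ p : M, rangeMeanCurvature I I' F p = 0

end RiemannianMaps

/-! Choose a local orthonormal frame `X i` of `D` and let `B(w, h) = ∑ ⟨X i, h⟩ ∇_w (X i)` (this is
`frameDeriv`). For `h` in `D` its component in `Dᗮ` is the second fundamental form of `D`. For a
section `σ` of `range F_*`, the vector `∇^F_x σ` differs from `B(F_* x, σ)` by an element of `D`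
(`pullbackCov_sub_frameDeriv_mem`), so everything reduces to showing that `B` maps `K × K` into `K`,
where `K = range F_{*p}`. Both conclusions follow from this.

Clairaut's relation makes `K` umbilical. Squared, it says that `e^{2g} |β'_D|²` is a constant
multiple of `|β'|²` along each geodesic. Differentiating at a point with velocity `h + V`, where `h
∈ D` and `V ∈ Dᗮ`, gives `dg(h + V) |h|² + ⟨B(h + V, h), h + V⟩ = 0`. The term `⟨B(w, h), h⟩`
vanishes because the frame is orthonormal, and `⟨B(V, h), V⟩` vanishes because `Dᗮ` is totally
geodesic. Subtracting the case `V = 0` leaves `⟨B(h, h), V⟩ = -dg(V) |h|²`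
(`inner_frameDeriv_of_clairaut`).

On `K`, `B` is symmetric modulo `K`, since the second fundamental form of `F` is symmetric. Since
`J` is parallel and `F` anti-invariant, `⟨B(w, h), J k⟩ = ⟨B(w, k), J h⟩`. As `dim K > 1`, each `k ∈
K` admits a nonzero `h ∈ K` orthogonal to it, and then `-dg(J k) |h|² = ⟨B(h, h), J k⟩ = ⟨B(h, k), J
h⟩ = -dg(J h) ⟨h, k⟩ = 0`. Hence `dg` vanishes on `J K`, which is all of `Kᗮ` by the Lagrangian
condition, and the umbilical form is zero (`mem_of_umbilical_of_lagrangian`).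

The analytic input is the calculus of `∇^F` and the existence of a geodesic with any given initial
velocity. -/

/-! ### Differentiable vector fields along a map -/

section AlongMaps

variable {E : Type*} [NormedAddCommGroup E] [NormedSpace ℝ E]
  {H : Type*} [TopologicalSpace H] {I : ModelWithCorners ℝ E H}
  {M : Type*} [TopologicalSpace M] [ChartedSpace H M]
  {E' : Type*} [NormedAddCommGroup E'] [NormedSpace ℝ E']
  {H' : Type*} [TopologicalSpace H'] {I' : ModelWithCorners ℝ E' H'}
  {N : Type*} [TopologicalSpace N] [ChartedSpace H' N] [IsManifold I' ∞ N]
  {F : M → N} {p : M}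

/-- The coordinates of a vector field along `F` in the preferred trivialization at `F p`. -/
noncomputable abbrev coordAlong (F : M → N) (σ : Π q : M, TangentSpace I' (F q)) (p : M) : M → E' :=
  fun q ↦ (trivializationAt E' (TangentSpace I' : N → Type _) (F p) ⟨F q, σ q⟩).2

variable (I I') in
/-- The vector field `σ` along `F` is differentiable at `p`. -/
abbrev MDiffAlongAt (F : M → N) (σ : Π q : M, TangentSpace I' (F q)) (p : M) : Prop :=
  MDifferentiableAt I I'.tangent (fun q ↦ (⟨F q, σ q⟩ : TangentBundle I' N)) p

theorem mdiffAlongAt_iff {σ : Π q : M, TangentSpace I' (F q)} :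
    MDiffAlongAt I I' F σ p ↔
      MDifferentiableAt I I' F p ∧ MDifferentiableAt I 𝓘(ℝ, E') (coordAlong F σ p) p :=
  mdifferentiableAt_totalSpace I' (fun q ↦ (⟨F q, σ q⟩ : TangentBundle I' N))

theorem eventually_mem_baseSet (hF : MDifferentiableAt I I' F p) :
    ∀ᶠ q in 𝓝 p, F q ∈ (trivializationAt E' (TangentSpace I' : N → Type _) (F p)).baseSet :=
  hF.continuousAt ((trivializationAt E' (TangentSpace I' : N → Type _) (F p)).open_baseSet.mem_nhds
    (mem_baseSet_trivializationAt' (F p)))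

omit [TopologicalSpace M] in
theorem coordAlong_eq {σ : Π q : M, TangentSpace I' (F q)} {q : M}
    (hq : F q ∈ (trivializationAt E' (TangentSpace I' : N → Type _) (F p)).baseSet) :
    coordAlong F σ p q =
      (trivializationAt E' (TangentSpace I' : N → Type _) (F p)).continuousLinearMapAt ℝ (F q)
        (σ q) := by
  rw [Trivialization.continuousLinearMapAt_apply, Trivialization.linearMapAt_apply, if_pos hq]

theorem coordAlong_add (hF : MDifferentiableAt I I' F p) (σ τ : Π q : M, TangentSpace I' (F q)) :
    coordAlong F (fun q ↦ σ q + τ q) p =ᶠ[𝓝 p] fun q ↦ coordAlong F σ p q + coordAlong F τ p q := by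
  filter_upwards [eventually_mem_baseSet hF] with q hq
  simp only [coordAlong_eq hq, map_add]

theorem coordAlong_smul (hF : MDifferentiableAt I I' F p) (f : M → ℝ)
    (σ : Π q : M, TangentSpace I' (F q)) :
    coordAlong F (fun q ↦ f q • σ q) p =ᶠ[𝓝 p] fun q ↦ f q • coordAlong F σ p q := by
  filter_upwards [eventually_mem_baseSet hF] with q hq
  simp only [coordAlong_eq hq, map_smul]

theorem coordAlong_congr {σ τ : Π q : M, TangentSpace I' (F q)} (h : ∀ᶠ q in 𝓝 p, σ q = τ q) :
    coordAlong F σ p =ᶠ[𝓝 p] coordAlong F τ p := by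
  filter_upwards [h] with q hq
  simp [coordAlong, hq]

theorem MDiffAlongAt.add {σ τ : Π q : M, TangentSpace I' (F q)}
    (hσ : MDiffAlongAt I I' F σ p) (hτ : MDiffAlongAt I I' F τ p) :
    MDiffAlongAt I I' F (fun q ↦ σ q + τ q) p := by
  rw [mdiffAlongAt_iff] at *
  exact ⟨hσ.1, (hσ.2.add hτ.2).congr_of_eventuallyEq (coordAlong_add hσ.1 σ τ)⟩

theorem MDiffAlongAt.smul {σ : Π q : M, TangentSpace I' (F q)} {f : M → ℝ}
    (hf : MDifferentiableAt I 𝓘(ℝ, ℝ) f p) (hσ : MDiffAlongAt I I' F σ p) :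
    MDiffAlongAt I I' F (fun q ↦ f q • σ q) p := by
  rw [mdiffAlongAt_iff] at *
  exact ⟨hσ.1, (hf.smul hσ.2).congr_of_eventuallyEq (coordAlong_smul hσ.1 f σ)⟩

theorem MDiffAlongAt.zero (hF : MDifferentiableAt I I' F p) :
    MDiffAlongAt I I' F (fun q ↦ (0 : TangentSpace I' (F q))) p := by
  rw [mdiffAlongAt_iff]
  refine ⟨hF, (mdifferentiableAt_const (c := (0 : E'))).congr_of_eventuallyEq ?_⟩
  filter_upwards [eventually_mem_baseSet hF] with q hq
  simp only [coordAlong_eq hq, map_zero]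

theorem MDiffAlongAt.sum {ι : Type*} {s : Finset ι} {σ : ι → Π q : M, TangentSpace I' (F q)}
    (hF : MDifferentiableAt I I' F p) (hσ : ∀ i ∈ s, MDiffAlongAt I I' F (σ i) p) :
    MDiffAlongAt I I' F (fun q ↦ ∑ i ∈ s, σ i q) p := by
  classical
  induction s using Finset.induction_on with
  | empty => simpa using MDiffAlongAt.zero hF
  | insert a s ha ih =>
    simp only [Finset.sum_insert ha]
    exact (hσ a (by simp)).add (ih fun i hi ↦ hσ i (by simp [hi]))

theorem MDiffAlongAt.comp {Y : Π y : N, TangentSpace I' y}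
    (hF : MDifferentiableAt I I' F p) (hY : MDiffAt (T% Y) (F p)) :
    MDiffAlongAt I I' F (fun q ↦ Y (F q)) p :=
  MDifferentiableAt.comp p hY hF

/-- A field along `F` is locally a combination of the restrictions of a local frame of `TN`. -/
theorem exists_eq_sum_frame [FiniteDimensional ℝ E'] {σ : Π q : M, TangentSpace I' (F q)}
    (hσ : MDiffAlongAt I I' F σ p) :
    ∃ (r : ℕ) (f : Fin r → M → ℝ) (e : Fin r → Π y : N, TangentSpace I' y),
      (∀ i, MDifferentiableAt I 𝓘(ℝ, ℝ) (f i) p) ∧ (∀ i, MDiffAt (T% (e i)) (F p)) ∧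
      ∀ᶠ q in 𝓝 p, σ q = ∑ i, f i q • e i (F q) := by
  obtain ⟨hF, hc⟩ := mdiffAlongAt_iff.1 hσ
  let t := trivializationAt E' (TangentSpace I' : N → Type _) (F p)
  let b := Module.finBasis ℝ E'
  refine ⟨finrank ℝ E', fun i q ↦ b.equivFunL.toContinuousLinearMap (coordAlong F σ p q) i,
    t.localFrame b, fun i ↦ ?_, fun i ↦ ?_, ?_⟩
  · have h : Differentiable ℝ fun w : E' ↦ b.equivFunL.toContinuousLinearMap w i :=
      ((ContinuousLinearMap.proj i).comp b.equivFunL.toContinuousLinearMap).differentiable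
    exact MDifferentiableAt.comp (I' := 𝓘(ℝ, E')) p h.mdifferentiable.mdifferentiableAt hc
  · exact (contMDiffAt_localFrame_of_mem (I := I') 1 t b i
      (mem_baseSet_trivializationAt' (F p))).mdifferentiableAt (by simp)
  · filter_upwards [eventually_mem_baseSet hF] with q hq
    have h1 : σ q = t.symmL ℝ (F q) (coordAlong F σ p q) := by
      rw [coordAlong_eq hq, Trivialization.symmL_continuousLinearMapAt _ hq]
    rw [h1]
    conv_lhs => rw [← b.sum_equivFun (coordAlong F σ p q), map_sum]
    refine Finset.sum_congr rfl fun i _ ↦ ?_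
    rw [map_smul, Trivialization.localFrame_apply_of_mem_baseSet t b hq]
    rw [Trivialization.symmL_apply t hq]
    simp [Trivialization.basisAt]

/-- To prove a property of fields along `F` it suffices to check it for restrictions of vector
fields of the target, if it is additive, compatible with multiplication by functions and local. -/
theorem MDiffAlongAt.induction [FiniteDimensional ℝ E'] {P : (Π q : M, TangentSpace I' (F q)) → Prop}
    {σ : Π q : M, TangentSpace I' (F q)} (hσ : MDiffAlongAt I I' F σ p)
    (comp : ∀ Y : Π y : N, TangentSpace I' y, MDiffAt (T% Y) (F p) → P fun q ↦ Y (F q))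
    (add : ∀ σ τ, MDiffAlongAt I I' F σ p → MDiffAlongAt I I' F τ p → P σ → P τ →
      P fun q ↦ σ q + τ q)
    (smul : ∀ (f : M → ℝ) (σ), MDifferentiableAt I 𝓘(ℝ, ℝ) f p → MDiffAlongAt I I' F σ p → P σ →
      P fun q ↦ f q • σ q)
    (congr : ∀ σ τ, MDiffAlongAt I I' F σ p → (∀ᶠ q in 𝓝 p, τ q = σ q) → P σ → P τ) : P σ := by
  classical
  obtain ⟨hF, -⟩ := mdiffAlongAt_iff.1 hσ
  obtain ⟨r, f, e, hf, he, h⟩ := exists_eq_sum_frame hσ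
  have hd (i) : MDiffAlongAt I I' F (fun q ↦ f i q • e i (F q)) p :=
    MDiffAlongAt.smul (hf i) (.comp hF (he i))
  have key (s : Finset (Fin r)) : P fun q ↦ ∑ i ∈ s, f i q • e i (F q) := by
    induction s using Finset.induction_on with
    | empty =>
      simpa using comp (fun _ ↦ 0) (mdifferentiableAt_zeroSection ..)
    | insert a s ha ih =>
      simp only [Finset.sum_insert ha]
      exact add _ _ (hd a) (.sum hF fun i _ ↦ hd i) (smul _ _ (hf a) (.comp hF (he a))
        (comp _ (he a))) ih
  exact congr _ _ (.sum hF fun i _ ↦ hd i) h (key Finset.univ)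

end AlongMaps

/-! ### Calculus of the pullback connection -/

section PullbackConnection

variable {E : Type*} [NormedAddCommGroup E] [NormedSpace ℝ E]
  {H : Type*} [TopologicalSpace H] {I : ModelWithCorners ℝ E H}
  {M : Type*} [TopologicalSpace M] [ChartedSpace H M]
  {E' : Type*} [NormedAddCommGroup E'] [NormedSpace ℝ E'] [FiniteDimensional ℝ E']
  {H' : Type*} [TopologicalSpace H'] {I' : ModelWithCorners ℝ E' H'}
  {N : Type*} [TopologicalSpace N] [ChartedSpace H' N] [IsManifold I' ∞ N]
  [RiemannianBundle (fun y : N ↦ TangentSpace I' y)]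
  [IsContMDiffRiemannianBundle I' ∞ E' (fun y : N ↦ TangentSpace I' y)]
  {F : M → N} {p : M}

-- Holds only near `y`: the extension has constant coordinates in the trivialization at `y`, which
-- is linear on fibres over its base set alone.
omit [FiniteDimensional ℝ E'] [RiemannianBundle (fun y : N ↦ TangentSpace I' y)]
  [IsContMDiffRiemannianBundle I' ∞ E' (fun y : N ↦ TangentSpace I' y)] in
theorem extend_tangent_add {y : N} (v w : TangentSpace I' y) :
    ∀ᶠ z in 𝓝 y, (extend E' (v + w) z : TangentSpace I' z) = extend E' v z + extend E' w z := by
  have hy := mem_baseSet_trivializationAt' (F := E') (E := (TangentSpace I' : N → Type _)) y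
  let t := trivializationAt E' (TangentSpace I' : N → Type _) y
  have h : (t ⟨y, v + w⟩).2 = (t ⟨y, v⟩).2 + (t ⟨y, w⟩).2 := (t.linear ℝ hy).map_add v w
  filter_upwards [t.open_baseSet.mem_nhds hy] with z hz
  simp only [extend]
  rw [h, ← t.symmL_apply (R := ℝ) hz, map_add, t.symmL_apply hz, t.symmL_apply hz]

omit [FiniteDimensional ℝ E'] [RiemannianBundle (fun y : N ↦ TangentSpace I' y)]
  [IsContMDiffRiemannianBundle I' ∞ E' (fun y : N ↦ TangentSpace I' y)] in
theorem extend_tangent_smul {y : N} (a : ℝ) (v : TangentSpace I' y) :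
    ∀ᶠ z in 𝓝 y, (extend E' (a • v) z : TangentSpace I' z) = a • extend E' v z := by
  have hy := mem_baseSet_trivializationAt' (F := E') (E := (TangentSpace I' : N → Type _)) y
  let t := trivializationAt E' (TangentSpace I' : N → Type _) y
  have h : (t ⟨y, a • v⟩).2 = a • (t ⟨y, v⟩).2 := (t.linear ℝ hy).map_smul a v
  filter_upwards [t.open_baseSet.mem_nhds hy] with z hz
  simp only [extend]
  rw [h, ← t.symmL_apply (R := ℝ) hz, map_smul, t.symmL_apply hz]

theorem leviCivita_congr {Y Z : Π y : N, TangentSpace I' y} {y : N} (hY : MDiffAt (T% Y) y)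
    (hZ : MDiffAt (T% Z) y) (h : ∀ᶠ z in 𝓝 y, Y z = Z z) :
    leviCivita I' N Y y = leviCivita I' N Z y :=
  (leviCivita I' N).isCovariantDerivativeOnUniv.congr_of_eventuallyEq hY hZ Filter.univ_mem h

theorem leviCivita_sum_smul {ι : Type*} (s : Finset ι) {f : ι → N → ℝ}
    {Y : ι → Π y : N, TangentSpace I' y} {y : N} (hf : ∀ i ∈ s, MDiffAt (f i) y)
    (hY : ∀ i ∈ s, MDiffAt (T% (Y i)) y) (w : TangentSpace I' y) :
    leviCivita I' N (fun z ↦ ∑ i ∈ s, f i z • Y i z) y w =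
      ∑ i ∈ s, (f i y • leviCivita I' N (Y i) y w + mvfderiv I' (f i) y w • Y i y) := by
  classical
  induction s using Finset.induction_on with
  | empty =>
    simp only [Finset.sum_empty]
    exact congrArg (fun A ↦ A w) ((leviCivita I' N).isCovariantDerivativeOnUniv.zero (x := y))
  | insert a s ha ih =>
    simp only [Finset.sum_insert ha]
    rw [← ih (fun i hi ↦ hf i (by simp [hi])) fun i hi ↦ hY i (by simp [hi])]
    have h1 : MDiffAt (T% (f a • Y a)) y := (hf a (by simp)).smul_section (hY a (by simp))
    have h2 : MDiffAt (T% (fun z ↦ ∑ i ∈ s, f i z • Y i z)) y :=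
      .sum_section fun i hi ↦ (hf i (by simp [hi])).smul_section (hY i (by simp [hi]))
    have h3 := (leviCivita I' N).isCovariantDerivativeOnUniv.add h1 h2
    rw [(leviCivita I' N).isCovariantDerivativeOnUniv.leibniz (hY a (by simp)) (hf a (by simp))]
      at h3
    exact congrArg (fun A ↦ A w) h3

theorem pullbackCov_congr {σ τ : Π q : M, TangentSpace I' (F q)} (h : ∀ᶠ q in 𝓝 p, σ q = τ q)
    (v : TangentSpace I p) : pullbackCov I I' F σ p v = pullbackCov I I' F τ p v := by
  rw [pullbackCov, pullbackCov, h.self_of_nhds]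
  have := (coordAlong_congr h).mfderiv_eq (I := I) (I' := 𝓘(ℝ, E'))
  congr 2
  simp only [mvfderiv]
  rw [this]
  rfl

theorem pullbackCov_add {σ τ : Π q : M, TangentSpace I' (F q)}
    (hσ : MDiffAlongAt I I' F σ p) (hτ : MDiffAlongAt I I' F τ p) (v : TangentSpace I p) :
    pullbackCov I I' F (fun q ↦ σ q + τ q) p v =
      pullbackCov I I' F σ p v + pullbackCov I I' F τ p v := by
  rw [mdiffAlongAt_iff] at hσ hτ
  have h1 : mvfderiv I (coordAlong F (fun q ↦ σ q + τ q) p) p =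
      mvfderiv I (coordAlong F σ p) p + mvfderiv I (coordAlong F τ p) p := by
    rw [← mvfderiv_fun_add hσ.2 hτ.2]
    simp only [mvfderiv]
    rw [(coordAlong_add hσ.1 σ τ).mfderiv_eq]
    rfl
  have hσe := mdifferentiableAt_extend I' E' (σ p)
  have hτe := mdifferentiableAt_extend I' E' (τ p)
  have h2 := (leviCivita I' N).isCovariantDerivativeOnUniv.add hσe hτe
  simp only [pullbackCov]
  rw [h1, leviCivita_congr (mdifferentiableAt_extend ..)
    (mdifferentiableAt_add_section hσe hτe) (extend_tangent_add _ _), h2]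
  simp only [_root_.add_apply, map_add]
  abel

theorem pullbackCov_smul {σ : Π q : M, TangentSpace I' (F q)} {f : M → ℝ}
    (hf : MDifferentiableAt I 𝓘(ℝ, ℝ) f p)
    (hσ : MDiffAlongAt I I' F σ p) (v : TangentSpace I p) :
    pullbackCov I I' F (fun q ↦ f q • σ q) p v =
      f p • pullbackCov I I' F σ p v + mvfderiv I f p v • σ p := by
  rw [mdiffAlongAt_iff] at hσ
  have h1 : mvfderiv I (coordAlong F (fun q ↦ f q • σ q) p) p =
      f p • mvfderiv I (coordAlong F σ p) p + (mvfderiv I f p).smulRight (coordAlong F σ p p) := by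
    rw [← mvfderiv_fun_smul hf hσ.2]
    simp only [mvfderiv]
    rw [(coordAlong_smul hσ.1 f σ).mfderiv_eq]
    rfl
  have hσe := mdifferentiableAt_extend I' E' (σ p)
  have h2 := (leviCivita I' N).isCovariantDerivativeOnUniv.smul_const (f p) hσe
  have hp := mem_baseSet_trivializationAt' (F := E') (E := (TangentSpace I' : N → Type _)) (F p)
  simp only [pullbackCov]
  have h3 : MDiffAt (T% (f p • (extend E' (σ p) : Π z : N, TangentSpace I' z))) (F p) :=
    MDifferentiableAt.smul_section (f := fun _ ↦ f p) mdifferentiableAt_const hσe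
  rw [h1, leviCivita_congr (mdifferentiableAt_extend ..) h3 (extend_tangent_smul _ _), h2]
  simp only [_root_.add_apply, map_add, ContinuousLinearMap.smulRight_apply, map_smul,
    _root_.smul_apply, coordAlong_eq hp,
    Trivialization.symmL_continuousLinearMapAt _ hp, smul_add]
  abel

/-- In a local frame write `Y = ∑ fᵢ eᵢ`. The Leibniz rule splits `∇Y` into `∑ fᵢ ∇eᵢ`, the
derivative of the extension with frozen coefficients, and `∑ dfᵢ eᵢ`, which the chain rule
identifies with the coordinate derivative. These are the two terms defining `pullbackCov`. -/
theorem pullbackCov_comp {Y : Π y : N, TangentSpace I' y}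
    (hF : MDifferentiableAt I I' F p) (hY : MDiffAt (T% Y) (F p)) (v : TangentSpace I p) :
    pullbackCov I I' F (fun q ↦ Y (F q)) p v = leviCivita I' N Y (F p) (mfderiv I I' F p v) := by
  let t := trivializationAt E' (TangentSpace I' : N → Type _) (F p)
  have hp : F p ∈ t.baseSet := mem_baseSet_trivializationAt' (F p)
  let b := Module.finBasis ℝ E'
  have hc : MDifferentiableAt I' 𝓘(ℝ, E') (fun y ↦ (t ⟨y, Y y⟩).2) (F p) :=
    (mdifferentiableAt_section I' Y).1 hY
  have hcF : mvfderiv I (fun q ↦ (t ⟨F q, Y (F q)⟩).2) p v =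
      mvfderiv I' (fun y ↦ (t ⟨y, Y y⟩).2) (F p) (mfderiv I I' F p v) :=
    mfderiv_comp_apply p hc hF v
  let e (i) := t.localFrame b i
  have he (i) : MDiffAt (T% (e i)) (F p) :=
    (contMDiffAt_localFrame_of_mem (I := I') 1 t b i hp).mdifferentiableAt (by simp)
  have hsum (y : N) (hy : y ∈ t.baseSet) (c : E') :
      t.symm y c = ∑ i, b.repr c i • e i y := by
    rw [← t.symmL_apply (R := ℝ) hy]
    conv_lhs => rw [← b.sum_repr c, map_sum]
    refine Finset.sum_congr rfl fun i _ ↦ ?_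
    rw [map_smul, t.symmL_apply hy]
    simp [e, Trivialization.localFrame_apply_of_mem_baseSet t b hy, Trivialization.basisAt]
  let f (i) : N → ℝ := fun y ↦ b.equivFunL.toContinuousLinearMap ((t ⟨y, Y y⟩).2) i
  have hlin (i) : Differentiable ℝ fun w : E' ↦ b.equivFunL.toContinuousLinearMap w i :=
    ((ContinuousLinearMap.proj i).comp b.equivFunL.toContinuousLinearMap).differentiable
  have hf (i) : MDiffAt (f i) (F p) :=
    MDifferentiableAt.comp (I' := 𝓘(ℝ, E')) _ (hlin i).mdifferentiable.mdifferentiableAt hc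
  have hdf (i) (w) : mvfderiv I' (f i) (F p) w =
      b.repr (mvfderiv I' (fun y ↦ (t ⟨y, Y y⟩).2) (F p) w) i := by
    have h1 := mfderiv_comp_apply (I' := 𝓘(ℝ, E')) (I'' := 𝓘(ℝ, ℝ)) (F p)
      (hlin i).mdifferentiable.mdifferentiableAt hc w
    have h2 : fderiv ℝ (fun w : E' ↦ b.equivFunL.toContinuousLinearMap w i)
        ((t ⟨F p, Y (F p)⟩).2) =
        (ContinuousLinearMap.proj i).comp b.equivFunL.toContinuousLinearMap :=
      ((ContinuousLinearMap.proj i).comp b.equivFunL.toContinuousLinearMap).fderiv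
    rw [mfderiv_eq_fderiv, h2] at h1
    exact h1
  have hYe : ∀ᶠ y in 𝓝 (F p), Y y = ∑ i, f i y • e i y := by
    filter_upwards [t.open_baseSet.mem_nhds hp] with y hy
    have := hsum y hy ((t ⟨y, Y y⟩).2)
    rw [Trivialization.symm_apply_apply_mk t hy] at this
    exact this
  have hext : ∀ᶠ y in 𝓝 (F p), extend E' (Y (F p)) y = ∑ i, f i (F p) • e i y := by
    filter_upwards [t.open_baseSet.mem_nhds hp] with y hy
    exact hsum y hy _
  have hd1 : MDiffAt (T% (fun y ↦ ∑ i, f i y • e i y)) (F p) :=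
    .sum_section fun i _ ↦ (hf i).smul_section (he i)
  have hd2 : MDiffAt (T% (fun y ↦ ∑ i, (fun _ : N ↦ f i (F p)) y • e i y)) (F p) :=
    .sum_section fun i _ ↦ MDifferentiableAt.smul_section mdifferentiableAt_const (he i)
  rw [pullbackCov, hcF, leviCivita_congr (mdifferentiableAt_extend ..) hd2 hext,
    leviCivita_congr hY hd1 hYe, leviCivita_sum_smul _ (fun i _ ↦ hf i) fun i _ ↦ he i,
    leviCivita_sum_smul _ (fun i _ ↦ mdifferentiableAt_const) fun i _ ↦ he i,
    t.symmL_apply hp, hsum _ hp]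
  simp only [hdf, mvfderiv_const, Finset.sum_add_distrib, zero_apply, zero_smul,
    add_zero]
  rw [add_comm]

omit [FiniteDimensional ℝ E'] in
theorem MDiffAlongAt.inner {σ τ : Π q : M, TangentSpace I' (F q)}
    (hσ : MDiffAlongAt I I' F σ p) (hτ : MDiffAlongAt I I' F τ p) :
    MDifferentiableAt I 𝓘(ℝ, ℝ) (fun q ↦ inner ℝ (σ q) (τ q)) p :=
  MDifferentiableAt.inner_bundle (F := E') (E := fun y : N ↦ TangentSpace I' y) hσ hτ

/-- The pullback of the Levi-Civita connection is compatible with the metric. -/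
theorem mvfderiv_inner_along {σ τ : Π q : M, TangentSpace I' (F q)}
    (hσ : MDiffAlongAt I I' F σ p) (hτ : MDiffAlongAt I I' F τ p) (v : TangentSpace I p) :
    mvfderiv I (fun q ↦ inner ℝ (σ q) (τ q)) p v =
      inner ℝ (pullbackCov I I' F σ p v) (τ p) + inner ℝ (σ p) (pullbackCov I I' F τ p v) := by
  have hcongr {f g : M → ℝ} (h : f =ᶠ[𝓝 p] g) : mvfderiv I f p v = mvfderiv I g p v := by
    have h1 := h.mfderiv_eq (I := I) (I' := 𝓘(ℝ, ℝ))
    simp only [mvfderiv]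
    rw [h1]
    rfl
  obtain ⟨hF, -⟩ := mdiffAlongAt_iff.1 hσ
  -- Both sides are additive and obey the same Leibniz rule in each field, so two inductions reduce
  -- to restrictions of fields on the target, where metric compatibility and the chain rule apply.
  refine hσ.induction (P := fun σ ↦ mvfderiv I (fun q ↦ inner ℝ (σ q) (τ q)) p v =
      inner ℝ (pullbackCov I I' F σ p v) (τ p) +
        inner ℝ (σ p) (pullbackCov I I' F τ p v))
    (fun Y hY ↦ ?_) (fun σ' τ' h1 h2 e1 e2 ↦ ?_) (fun f σ' hf h1 e1 ↦ ?_)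
    fun σ' τ' h1 h e1 ↦ ?_
  · refine hτ.induction (P := fun σ ↦ mvfderiv I (fun q ↦ inner ℝ (Y (F q)) (σ q)) p v =
      inner ℝ (pullbackCov I I' F (fun q ↦ Y (F q)) p v) (σ p) +
        inner ℝ (Y (F p)) (pullbackCov I I' F σ p v))
      (fun Z hZ ↦ ?_) (fun σ' τ' h1 h2 e1 e2 ↦ ?_) (fun f σ' hf h1 e1 ↦ ?_)
      fun σ' τ' h1 h e1 ↦ ?_
    · rw [pullbackCov_comp hF hY, pullbackCov_comp hF hZ]
      have h := leviCivita_metric (mdifferentiableAt_extend I' E' (mfderiv I I' F p v)) hY hZ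
      simp only [extend_apply_self] at h
      rw [← h]
      exact mfderiv_comp_apply p (mdiffAt_inner hY hZ) hF v
    · have hY' := MDiffAlongAt.comp (I := I) hF hY
      simp only [inner_add_right]
      rw [mvfderiv_fun_add (hY'.inner h1) (hY'.inner h2), _root_.add_apply, e1, e2,
        pullbackCov_add h1 h2, inner_add_right]
      ring
    · have hY' := MDiffAlongAt.comp (I := I) hF hY
      simp only [inner_smul_right]
      rw [mvfderiv_fun_mul hf (hY'.inner h1), pullbackCov_smul hf h1]
      simp only [_root_.add_apply, _root_.smul_apply, e1, inner_add_right,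
        inner_smul_right, smul_eq_mul]
      ring
    · rw [pullbackCov_congr h, h.self_of_nhds, ← e1]
      exact hcongr (h.mono fun q hq ↦ by simp only [hq])
  · simp only [inner_add_left]
    rw [mvfderiv_fun_add (h1.inner hτ) (h2.inner hτ), _root_.add_apply, e1, e2,
      pullbackCov_add h1 h2, inner_add_left]
    ring
  · simp only [inner_smul_left, conj_trivial]
    rw [mvfderiv_fun_mul hf (h1.inner hτ), pullbackCov_smul hf h1]
    simp only [_root_.add_apply, _root_.smul_apply, e1, inner_add_left,
      inner_smul_left, smul_eq_mul, conj_trivial]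
    ring
  · rw [pullbackCov_congr h, h.self_of_nhds, ← e1]
    exact hcongr (h.mono fun q hq ↦ by simp only [hq])

theorem pullbackCov_sum_smul_comp {ι : Type*} (s : Finset ι) {f : ι → M → ℝ}
    {Y : ι → Π y : N, TangentSpace I' y} (hF : MDifferentiableAt I I' F p)
    (hf : ∀ i ∈ s, MDifferentiableAt I 𝓘(ℝ, ℝ) (f i) p)
    (hY : ∀ i ∈ s, MDiffAt (T% (Y i)) (F p)) (v : TangentSpace I p) :
    pullbackCov I I' F (fun q ↦ ∑ i ∈ s, f i q • Y i (F q)) p v =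
      ∑ i ∈ s, (f i p • leviCivita I' N (Y i) (F p) (mfderiv I I' F p v) +
        mvfderiv I (f i) p v • Y i (F p)) := by
  classical
  induction s using Finset.induction_on with
  | empty =>
    have h := pullbackCov_comp (Y := fun _ ↦ 0) hF (mdifferentiableAt_zeroSection ..) v
    simp only [Finset.sum_empty]
    rw [h]
    exact congrArg (fun A ↦ A (mfderiv I I' F p v))
      ((leviCivita I' N).isCovariantDerivativeOnUniv.zero (x := F p))
  | insert a s ha ih =>
    simp only [Finset.sum_insert ha]
    have h1 := MDiffAlongAt.comp (I := I) hF (hY a (by simp))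
    have h2 : MDiffAlongAt I I' F (fun q ↦ ∑ i ∈ s, f i q • Y i (F q)) p :=
      .sum hF fun i hi ↦ .smul (hf i (by simp [hi])) (.comp hF (hY i (by simp [hi])))
    rw [pullbackCov_add (.smul (hf a (by simp)) h1) h2, pullbackCov_smul (hf a (by simp)) h1,
      pullbackCov_comp hF (hY a (by simp)),
      ih (fun i hi ↦ hf i (by simp [hi])) fun i hi ↦ hY i (by simp [hi])]

end PullbackConnection

/-! ### Smooth orthonormal frames -/

section OrthonormalFrames

variable {E' : Type*} [NormedAddCommGroup E'] [NormedSpace ℝ E']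
  {H' : Type*} [TopologicalSpace H'] {I' : ModelWithCorners ℝ E' H'}
  {N : Type*} [TopologicalSpace N] [ChartedSpace H' N] [IsManifold I' ∞ N]
  [RiemannianBundle (fun y : N ↦ TangentSpace I' y)]
  [IsContMDiffRiemannianBundle I' ∞ E' (fun y : N ↦ TangentSpace I' y)]
  {U : Set N} {r : ℕ} {X : Fin r → Π z : N, TangentSpace I' z}

theorem contMDiffOn_inner_tangent {Y Z : Π z : N, TangentSpace I' z}
    (hY : ContMDiffOn I' I'.tangent ∞ (T% Y) U) (hZ : ContMDiffOn I' I'.tangent ∞ (T% Z) U) :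
    ContMDiffOn I' 𝓘(ℝ, ℝ) ∞ (fun z ↦ inner ℝ (Y z) (Z z)) U :=
  ContMDiffOn.inner_bundle (F := E') (E := fun y : N ↦ TangentSpace I' y) hY hZ

theorem contMDiffOn_inv_norm {Y : Π z : N, TangentSpace I' z}
    (hY : ContMDiffOn I' I'.tangent ∞ (T% Y) U) (h0 : ∀ z ∈ U, Y z ≠ 0) :
    ContMDiffOn I' 𝓘(ℝ, ℝ) ∞ (fun z ↦ ‖Y z‖⁻¹) U := by
  have h (z : N) : ‖Y z‖⁻¹ = (Real.sqrt (inner ℝ (Y z) (Y z)))⁻¹ := by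
    rw [real_inner_self_eq_norm_sq, Real.sqrt_sq (norm_nonneg _)]
  simp only [h]
  intro z hz
  have hne : inner ℝ (Y z) (Y z) ≠ 0 := inner_self_ne_zero.2 (h0 z hz)
  have hs : ContDiffAt ℝ ∞ (fun x : ℝ ↦ (Real.sqrt x)⁻¹) (inner ℝ (Y z) (Y z)) :=
    (Real.contDiffAt_sqrt hne).inv (by
      rw [real_inner_self_eq_norm_sq, Real.sqrt_sq (norm_nonneg _)]
      exact norm_ne_zero_iff.2 (h0 z hz))
  exact ContMDiffAt.comp_contMDiffWithinAt (f := fun z ↦ inner ℝ (Y z) (Y z)) z hs.contMDiffAt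
    (contMDiffOn_inner_tangent hY hY z hz)

/-- Strong induction on `k`: the recursion divides only by norms of earlier vectors, nonzero by
linear independence. -/
theorem contMDiffOn_gramSchmidt
    (hX : ∀ i, ContMDiffOn I' I'.tangent ∞ (T% (X i)) U)
    (hli : ∀ z ∈ U, LinearIndependent ℝ (fun i ↦ X i z)) (k : Fin r) :
    ContMDiffOn I' I'.tangent ∞
      (T% (fun z ↦ InnerProductSpace.gramSchmidt ℝ (fun i ↦ X i z) k)) U := by
  induction k using WellFoundedLT.induction with
  | ind k ih =>
    have hne (i : Fin r) (z : N) (hz : z ∈ U) :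
        InnerProductSpace.gramSchmidt ℝ (fun i ↦ X i z) i ≠ 0 :=
      InnerProductSpace.gramSchmidt_ne_zero i (hli z hz)
    have hs : ContMDiffOn I' I'.tangent ∞ (T% (fun z ↦ ∑ i ∈ Finset.Iio k,
        (inner ℝ (InnerProductSpace.gramSchmidt ℝ (fun i ↦ X i z) i) (X k z) *
          (‖InnerProductSpace.gramSchmidt ℝ (fun i ↦ X i z) i‖⁻¹ *
            ‖InnerProductSpace.gramSchmidt ℝ (fun i ↦ X i z) i‖⁻¹)) •
          InnerProductSpace.gramSchmidt ℝ (fun i ↦ X i z) i)) U := by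
      refine .sum_section fun i hi ↦ ?_
      have hi' := ih i (Finset.mem_Iio.1 hi)
      have hn := contMDiffOn_inv_norm hi' (hne i)
      exact ((contMDiffOn_inner_tangent hi' (hX k)).mul (hn.mul hn)).smul_section hi'
    refine ((hX k).sub_section hs).congr fun z _ ↦ ?_
    congr 1
    have h := InnerProductSpace.gramSchmidt_def'' ℝ (fun i ↦ X i z) k
    rw [Pi.sub_apply, eq_sub_iff_add_eq]
    refine Eq.trans ?_ h.symm
    congr 1
    refine Finset.sum_congr rfl fun i _ ↦ ?_
    congr 1
    simp [div_eq_mul_inv, pow_two]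

/-- The Gram-Schmidt process turns a smooth local frame of a distribution into an orthonormal one. -/
theorem exists_orthonormal_frame
    (hX : ∀ i, ContMDiffOn I' I'.tangent ∞ (T% (X i)) U)
    (hli : ∀ z ∈ U, LinearIndependent ℝ (fun i ↦ X i z)) :
    ∃ Y : Fin r → Π z : N, TangentSpace I' z,
      (∀ i, ContMDiffOn I' I'.tangent ∞ (T% (Y i)) U) ∧
      ∀ z ∈ U, Orthonormal ℝ (fun i ↦ Y i z) ∧
        Submodule.span ℝ (Set.range fun i ↦ Y i z) = Submodule.span ℝ (Set.range fun i ↦ X i z) := by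
  refine ⟨fun k z ↦ InnerProductSpace.gramSchmidtNormed ℝ (fun i ↦ X i z) k, fun k ↦ ?_,
    fun z hz ↦ ⟨InnerProductSpace.gramSchmidtNormed_orthonormal (hli z hz), ?_⟩⟩
  · have h := contMDiffOn_gramSchmidt hX hli k
    exact (contMDiffOn_inv_norm h fun z hz ↦
      InnerProductSpace.gramSchmidt_ne_zero k (hli z hz)).smul_section h
  · exact (InnerProductSpace.span_gramSchmidtNormed_range _).trans
      (InnerProductSpace.span_gramSchmidt ℝ _)

/-- The tangent bundle has smooth local orthonormal frames. -/
theorem exists_orthonormal_frame_tangent [FiniteDimensional ℝ E'] (y : N) :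
    ∃ U : Set N, IsOpen U ∧ y ∈ U ∧ ∃ Y : Fin (finrank ℝ E') → Π z : N, TangentSpace I' z,
      (∀ i, ContMDiffOn I' I'.tangent ∞ (T% (Y i)) U) ∧
      ∀ z ∈ U, Orthonormal ℝ (fun i ↦ Y i z) ∧ Submodule.span ℝ (Set.range fun i ↦ Y i z) = ⊤ := by
  let t := trivializationAt E' (TangentSpace I' : N → Type _) y
  let b := Module.finBasis ℝ E'
  have hf := t.isLocalFrameOn_localFrame_baseSet I' ∞ b
  obtain ⟨Y, hY, h⟩ := exists_orthonormal_frame (X := t.localFrame b)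
    (fun i ↦ hf.contMDiffOn i) fun z hz ↦ hf.linearIndependent hz
  refine ⟨t.baseSet, t.open_baseSet, mem_baseSet_trivializationAt' y, Y, hY, fun z hz ↦
    ⟨(h z hz).1, (h z hz).2.trans (top_le_iff.1 (hf.generating hz))⟩⟩

end OrthonormalFrames

/-! ### Differentiability of push-forward fields -/

section TangentMap

variable {E : Type*} [NormedAddCommGroup E] [NormedSpace ℝ E]
  {H : Type*} [TopologicalSpace H] {I : ModelWithCorners ℝ E H}
  {M : Type*} [TopologicalSpace M] [ChartedSpace H M] [IsManifold I ∞ M]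
  {E' : Type*} [NormedAddCommGroup E'] [NormedSpace ℝ E']
  {H' : Type*} [TopologicalSpace H'] {I' : ModelWithCorners ℝ E' H'}
  {N : Type*} [TopologicalSpace N] [ChartedSpace H' N] [IsManifold I' ∞ N]
  {F : M → N} {p : M}

/-- The field is the tangent map of `F` composed with the section `Y`. The local form on `s` is
needed for velocities of curves that are smooth only on an interval. -/
theorem mdiffAlongAt_mfderiv_of_contMDiffOn {s : Set M} (hs : IsOpen s) (hp : p ∈ s)
    (hF : ContMDiffOn I I' ∞ F s) {Y : Π q : M, TangentSpace I q} (hY : MDiffAt (T% Y) p) :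
    MDiffAlongAt I I' F (fun q ↦ mfderiv I I' F q (Y q)) p := by
  have h : ContMDiffOn I.tangent I'.tangent 1 (tangentMapWithin I I' F s)
      (π E (TangentSpace I) ⁻¹' s) :=
    hF.contMDiffOn_tangentMapWithin (by
      rw [one_add_one_eq_two]
      exact ENat.LEInfty.out) hs.uniqueMDiffOn
  have hs' : IsOpen (π E (TangentSpace I : M → Type _) ⁻¹' s) :=
    hs.preimage (FiberBundle.continuous_proj E (TangentSpace I : M → Type _))
  have h1 : MDifferentiableAt I.tangent I'.tangent (tangentMapWithin I I' F s) ⟨p, Y p⟩ :=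
    (h.contMDiffAt (hs'.mem_nhds hp)).mdifferentiableAt (by simp)
  refine (MDifferentiableAt.comp p h1 hY).congr_of_eventuallyEq ?_
  filter_upwards [hs.mem_nhds hp] with q hq
  simp [tangentMapWithin, mfderivWithin_of_isOpen hs hq]

theorem mdiffAlongAt_mfderiv (hF : ContMDiff I I' ∞ F) {Y : Π q : M, TangentSpace I q}
    (hY : MDiffAt (T% Y) p) : MDiffAlongAt I I' F (fun q ↦ mfderiv I I' F q (Y q)) p :=
  mdiffAlongAt_mfderiv_of_contMDiffOn isOpen_univ (mem_univ p) hF.contMDiffOn hY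

end TangentMap

/-! ### Symmetry of the second fundamental form of a map -/

section SecondFundamentalForm

variable {E : Type*} [NormedAddCommGroup E] [NormedSpace ℝ E]
  {H : Type*} [TopologicalSpace H] {I : ModelWithCorners ℝ E H} [I.Boundaryless]
  {M : Type*} [TopologicalSpace M] [ChartedSpace H M] [IsManifold I ∞ M]
  {E' : Type*} [NormedAddCommGroup E'] [NormedSpace ℝ E']
  {H' : Type*} [TopologicalSpace H'] {I' : ModelWithCorners ℝ E' H'}
  {N : Type*} [TopologicalSpace N] [ChartedSpace H' N] [IsManifold I' ∞ N]
  {F : M → N} {p : M}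

theorem trivializationAt_tangent_snd {y z : N} (hz : z ∈ (chartAt H' y).source)
    (v : TangentSpace I' z) :
    (trivializationAt E' (TangentSpace I' : N → Type _) y ⟨z, v⟩).2 =
      (mfderiv I' 𝓘(ℝ, E') (extChartAt I' y) z v : E') := by
  have h := congrArg (fun A : TangentSpace I' z →L[ℝ] E' ↦ A v)
    (TangentBundle.continuousLinearMapAt_trivializationAt (I := I') hz)
  refine Eq.trans ?_ h
  have hb : z ∈ (trivializationAt E' (TangentSpace I' : N → Type _) y).baseSet := hz
  simp only [Trivialization.continuousLinearMapAt_apply, Trivialization.linearMapAt_apply, if_pos hb]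

theorem mpullbackWithin_extend {y : N} (v : TangentSpace I' y) :
    ∀ᶠ u in 𝓝[range I'] (extChartAt I' y y),
      mpullbackWithin 𝓘(ℝ, E') I' (extChartAt I' y).symm (extend E' v) (range I') u =
        (trivializationAt E' (TangentSpace I' : N → Type _) y ⟨y, v⟩).2 := by
  filter_upwards [extChartAt_target_mem_nhdsWithin (I := I') y] with u hu
  have hs : (extChartAt I' y).symm u ∈ (chartAt H' y).source := by
    rw [← extChartAt_source I']
    exact (extChartAt I' y).map_target hu
  have hb : (extChartAt I' y).symm u ∈
      (trivializationAt E' (TangentSpace I' : N → Type _) y).baseSet := hs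
  have h1 := TangentBundle.symmL_trivializationAt (I := I') hs
  rw [(extChartAt I' y).right_inv hu] at h1
  have hinv := isInvertible_mfderivWithin_extChartAt_symm (I := I') hu
  refine hinv.inverse_apply_eq.2 ?_
  refine (Trivialization.symmL_apply (R := ℝ) _ hb _).symm.trans ?_
  exact congrArg (fun A : E' →L[ℝ] TangentSpace I' ((extChartAt I' y).symm u) ↦
    A (trivializationAt E' (TangentSpace I' : N → Type _) y ⟨y, v⟩).2) h1

/-- In the chart at `y` both extensions are constant fields, and constant fields commute. -/
theorem mlieBracket_extend {y : N} (v w : TangentSpace I' y) :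
    mlieBracket I' (extend E' v) (extend E' w) y = 0 := by
  rw [← mlieBracketWithin_univ, mlieBracketWithin_apply]
  simp only [preimage_univ, univ_inter]
  have h : lieBracketWithin ℝ
      (mpullbackWithin 𝓘(ℝ, E') I' (extChartAt I' y).symm (extend E' v) (range I'))
      (mpullbackWithin 𝓘(ℝ, E') I' (extChartAt I' y).symm (extend E' w) (range I'))
      (range I') (extChartAt I' y y) = 0 := by
    rw [Filter.EventuallyEq.lieBracketWithin_vectorField_eq_of_mem
      (mpullbackWithin_extend v) (mpullbackWithin_extend w) (by simp)]
    simp [lieBracketWithin]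
  exact (congrArg _ h).trans (map_zero (mfderiv I' 𝓘(ℝ, E') (extChartAt I' y) y).inverse)

/-- Expresses the push-forward of a chart-constant field through the first derivative of the local
representative of `F`, so that differentiating once more produces its second derivative. -/
theorem coordAlong_mfderiv_extend (hF : ContMDiff I I' ∞ F) (x : TangentSpace I p) :
    coordAlong F (fun q ↦ mfderiv I I' F q (extend E x q)) p =ᶠ[𝓝 p] fun q ↦
      fderiv ℝ (extChartAt I' (F p) ∘ F ∘ (extChartAt I p).symm) (extChartAt I p q)
        (trivializationAt E (TangentSpace I : M → Type _) p ⟨p, x⟩).2 := by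
  have hFd := hF.mdifferentiable (by simp)
  filter_upwards [eventually_mem_baseSet (hFd p), extChartAt_source_mem_nhds (I := I) p] with q hq hs
  have hs' : q ∈ (chartAt H p).source := by rwa [← extChartAt_source I]
  have hb : q ∈ (trivializationAt E (TangentSpace I : M → Type _) p).baseSet := hs'
  have h1 := TangentBundle.symmL_trivializationAt (I := I) hs'
  rw [I.range_eq_univ, mfderivWithin_univ] at h1
  have h2 : extend E x q = mfderiv 𝓘(ℝ, E) I (extChartAt I p).symm (extChartAt I p q)
      (trivializationAt E (TangentSpace I : M → Type _) p ⟨p, x⟩).2 :=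
    (Trivialization.symmL_apply (R := ℝ) _ hb _).symm.trans
      (congrArg (fun A : E →L[ℝ] TangentSpace I q ↦
        A (trivializationAt E (TangentSpace I : M → Type _) p ⟨p, x⟩).2) h1)
  have hu : extChartAt I p q ∈ (extChartAt I p).target := (extChartAt I p).map_source hs
  have e : (extChartAt I p).symm (extChartAt I p q) = q := (extChartAt I p).left_inv hs
  have d1 : MDifferentiableAt 𝓘(ℝ, E) I (extChartAt I p).symm (extChartAt I p q) := by
    have := mdifferentiableWithinAt_extChartAt_symm (I := I) hu
    rwa [I.range_eq_univ, mdifferentiableWithinAt_univ] at this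
  have d2 : MDifferentiableAt I' 𝓘(ℝ, E') (extChartAt I' (F p)) (F q) := mdifferentiableAt_extChartAt hq
  have d3 : MDifferentiableAt I 𝓘(ℝ, E') (extChartAt I' (F p) ∘ F) q := d2.comp q (hFd q)
  have h3 := mfderiv_comp_apply_of_eq _ d3 d1 e
    (trivializationAt E (TangentSpace I : M → Type _) p ⟨p, x⟩).2
  have h4 := mfderiv_comp_apply q d2 (hFd q) (extend E x q)
  refine (trivializationAt_tangent_snd hq _).trans (h4.symm.trans ?_)
  rw [mfderiv_eq_fderiv] at h3
  refine Eq.trans ?_ h3.symm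
  rw [e, h2]
  rfl

variable [FiniteDimensional ℝ E'] [RiemannianBundle (fun y : N ↦ TangentSpace I' y)]
  [IsContMDiffRiemannianBundle I' ∞ E' (fun y : N ↦ TangentSpace I' y)]

-- Both sides are values of the second derivative of the representative of `F` in charts, which is
-- symmetric.
omit [FiniteDimensional ℝ E'] [RiemannianBundle (fun y : N ↦ TangentSpace I' y)]
  [IsContMDiffRiemannianBundle I' ∞ E' (fun y : N ↦ TangentSpace I' y)] in
theorem mvfderiv_coordAlong_symm (hF : ContMDiff I I' ∞ F) (x y : TangentSpace I p) :
    mvfderiv I (coordAlong F (fun q ↦ mfderiv I I' F q (extend E y q)) p) p x =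
      mvfderiv I (coordAlong F (fun q ↦ mfderiv I I' F q (extend E x q)) p) p y := by
  let G := extChartAt I' (F p) ∘ F ∘ (extChartAt I p).symm
  have hG : ContDiffAt ℝ ∞ G (extChartAt I p p) := by
    have := ((contMDiffAt_iff (x := p)).1 hF.contMDiffAt).2
    rwa [I.range_eq_univ, contDiffWithinAt_univ] at this
  have hsymm : IsSymmSndFDerivAt ℝ G (extChartAt I p p) :=
    hG.isSymmSndFDerivAt (by
      rw [minSmoothness_of_isRCLikeNormedField]
      exact ENat.LEInfty.out)
  have hG' : DifferentiableAt ℝ (fderiv ℝ G) (extChartAt I p p) :=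
    (hG.fderiv_right (m := 1) (by
      rw [one_add_one_eq_two]
      exact ENat.LEInfty.out)).differentiableAt (by simp)
  have key (a b : TangentSpace I p) :
      mvfderiv I (coordAlong F (fun q ↦ mfderiv I I' F q (extend E b q)) p) p a =
        fderiv ℝ (fderiv ℝ G) (extChartAt I p p) (mfderiv I 𝓘(ℝ, E) (extChartAt I p) p a)
          (trivializationAt E (TangentSpace I : M → Type _) p ⟨p, b⟩).2 := by
    have h1 := (coordAlong_mfderiv_extend hF b).mfderiv_eq (I := I) (I' := 𝓘(ℝ, E'))
    have d0 : MDifferentiableAt I 𝓘(ℝ, E) (extChartAt I p) p :=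
      mdifferentiableAt_extChartAt (mem_chart_source H p)
    have d1 : DifferentiableAt ℝ (fun u ↦ fderiv ℝ G u
        (trivializationAt E (TangentSpace I : M → Type _) p ⟨p, b⟩).2) (extChartAt I p p) :=
      hG'.clm_apply (differentiableAt_const _)
    have h2 := mfderiv_comp_apply p d1.mdifferentiableAt d0 a
    have h3 : fderiv ℝ (fun u ↦ fderiv ℝ G u
        (trivializationAt E (TangentSpace I : M → Type _) p ⟨p, b⟩).2) (extChartAt I p p)
        (mfderiv I 𝓘(ℝ, E) (extChartAt I p) p a) =
        fderiv ℝ (fderiv ℝ G) (extChartAt I p p) (mfderiv I 𝓘(ℝ, E) (extChartAt I p) p a)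
          (trivializationAt E (TangentSpace I : M → Type _) p ⟨p, b⟩).2 := by
      rw [fderiv_clm_apply hG' (differentiableAt_const _), fderiv_fun_const]
      simp only [Pi.zero_apply, ContinuousLinearMap.comp_zero, zero_add]
      rfl
    rw [mfderiv_eq_fderiv] at h2
    refine Eq.trans ?_ (h2.trans h3)
    exact congrArg (fun A : TangentSpace I p →L[ℝ] E' ↦ A a) h1
  have hs : p ∈ (chartAt H p).source := mem_chart_source H p
  have hx (a : TangentSpace I p) : mfderiv I 𝓘(ℝ, E) (extChartAt I p) p a =
      (trivializationAt E (TangentSpace I : M → Type _) p ⟨p, a⟩).2 :=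
    (trivializationAt_tangent_snd hs a).symm
  rw [key, key, hx, hx]
  exact hsymm _ _

/-- The second fundamental form of a smooth map is symmetric. -/
theorem pullbackCov_mfderiv_extend_symm (hF : ContMDiff I I' ∞ F) (x y : TangentSpace I p) :
    pullbackCov I I' F (fun q ↦ mfderiv I I' F q (extend E y q)) p x =
      pullbackCov I I' F (fun q ↦ mfderiv I I' F q (extend E x q)) p y := by
  have h1 := mvfderiv_coordAlong_symm hF x y
  -- The connection terms agree as well: there is no torsion and the two extensions commute at `F
  -- p`.
  have h2 := leviCivita_torsion (mdifferentiableAt_extend I' E' (mfderiv I I' F p x))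
    (mdifferentiableAt_extend I' E' (mfderiv I I' F p y))
  rw [mlieBracket_extend, sub_eq_zero] at h2
  simp only [extend_apply_self] at h2
  simp only [pullbackCov, extend_apply_self]
  rw [h2]
  exact congrArg (fun e ↦ (trivializationAt E' (TangentSpace I' : N → Type _) (F p)).symmL ℝ (F p) e
    + _) h1

end SecondFundamentalForm

/-! ### Geodesics as solutions of an ordinary differential equation -/

/-- Bootstrapping: if `α` is of class `C^n`, so is `α' = f ∘ α`, hence `α` is of class `C^(n+1)`. -/
theorem contDiffOn_of_hasDerivAt_autonomous {V : Type*} [NormedAddCommGroup V] [NormedSpace ℝ V]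
    {f : V → V} {S : Set V} (hf : ContDiffOn ℝ ∞ f S) {α : ℝ → V} {J : Set ℝ} (hJ : IsOpen J)
    (hα : ∀ t ∈ J, HasDerivAt α (f (α t)) t) (hS : MapsTo α J S) : ContDiffOn ℝ ∞ α J := by
  rw [contDiffOn_infty]
  intro n
  induction n with
  | zero => exact contDiffOn_zero.2 fun t ht ↦ (hα t ht).continuousAt.continuousWithinAt
  | succ n ih =>
    rw [Nat.cast_succ, contDiffOn_succ_iff_deriv_of_isOpen hJ]
    refine ⟨fun t ht ↦ (hα t ht).differentiableAt.differentiableWithinAt, by simp, ?_⟩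
    exact ((hf.of_le (by exact_mod_cast le_top)).comp ih hS).congr fun t ht ↦ (hα t ht).deriv

section Geodesics

variable {E' : Type*} [NormedAddCommGroup E'] [NormedSpace ℝ E'] [FiniteDimensional ℝ E']
  {H' : Type*} [TopologicalSpace H'] {I' : ModelWithCorners ℝ E' H'}
  {N : Type*} [TopologicalSpace N] [ChartedSpace H' N] [IsManifold I' ∞ N]
  [RiemannianBundle (fun y : N ↦ TangentSpace I' y)]
  [IsContMDiffRiemannianBundle I' ∞ E' (fun y : N ↦ TangentSpace I' y)]

omit [FiniteDimensional ℝ E'] [RiemannianBundle (fun y : N ↦ TangentSpace I' y)]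
  [IsContMDiffRiemannianBundle I' ∞ E' (fun y : N ↦ TangentSpace I' y)] in
theorem ContMDiffOn.mdiffAt_section {U : Set N} (hU : IsOpen U) {Y : Π z : N, TangentSpace I' z}
    (hY : ContMDiffOn I' I'.tangent ∞ (T% Y) U) {z : N} (hz : z ∈ U) : MDiffAt (T% Y) z :=
  (hY.contMDiffAt (hU.mem_nhds hz)).mdifferentiableAt (by simp)

/-- The connection coefficients of a smooth orthonormal frame are smooth. -/
theorem contMDiffOn_inner_leviCivita_of_orthonormal {r : ℕ} {U : Set N} (hU : IsOpen U)
    {Y : Fin r → Π z : N, TangentSpace I' z}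
    (hY : ∀ i, ContMDiffOn I' I'.tangent ∞ (T% (Y i)) U)
    (hon : ∀ z ∈ U, Orthonormal ℝ (fun i ↦ Y i z)) (i j k : Fin r) :
    ContMDiffOn I' 𝓘(ℝ, ℝ) ∞ (fun z ↦ inner ℝ (leviCivita I' N (Y j) z (Y i z)) (Y k z)) U := by
  have : IsManifold I' (minSmoothness ℝ 2) N := by
    rw [minSmoothness_of_isRCLikeNormedField]
    infer_instance
  have : IsManifold I' (∞ + 1) N := ‹IsManifold I' ∞ N›
  have hbr (i j : Fin r) : ContMDiffOn I' I'.tangent ∞ (T% (mlieBracket I' (Y i) (Y j))) U :=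
    fun z hz ↦ (ContMDiffAt.mlieBracket_vectorField (m := ⊤) (n := ⊤)
      ((hY i).contMDiffAt (hU.mem_nhds hz)) ((hY j).contMDiffAt (hU.mem_nhds hz))
      (by simp)).contMDiffWithinAt
  -- The inner products of the frame are constant, so only the bracket terms of the Koszul formula
  -- survive, and these are smooth.
  have h0 (i j : Fin r) (z : N) (hz : z ∈ U) :
      mvfderiv I' (fun y ↦ inner ℝ (Y i y) (Y j y)) z = 0 := by
    have hc : (fun y ↦ inner ℝ (Y i y) (Y j y)) =ᶠ[𝓝 z] fun _ ↦ if i = j then (1 : ℝ) else 0 := by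
      filter_upwards [hU.mem_nhds hz] with y hy
      exact orthonormal_iff_ite.1 (hon y hy) i j
    have h1 := hc.mfderiv_eq (I := I') (I' := 𝓘(ℝ, ℝ))
    rw [mfderiv_const] at h1
    ext w
    exact congrArg (fun A : TangentSpace I' z →L[ℝ] ℝ ↦ A w) h1
  have hs : ContMDiffOn I' 𝓘(ℝ, ℝ) ∞ (fun z ↦ (1 / 2 : ℝ) *
      (inner ℝ (mlieBracket I' (Y i) (Y j) z) (Y k z) -
        inner ℝ (mlieBracket I' (Y i) (Y k) z) (Y j z) -
        inner ℝ (mlieBracket I' (Y j) (Y k) z) (Y i z))) U :=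
    contMDiffOn_const.mul (((contMDiffOn_inner_tangent (hbr i j) (hY k)).sub
      (contMDiffOn_inner_tangent (hbr i k) (hY j))).sub
      (contMDiffOn_inner_tangent (hbr j k) (hY i)))
  refine hs.congr fun z hz ↦ ?_
  rw [inner_leviCivita ((hY j).mdiffAt_section hU hz) ((hY i).mdiffAt_section hU hz)
    ((hY k).mdiffAt_section hU hz), koszul, h0 j k z hz, h0 i k z hz, h0 i j z hz]
  simp

/-- If the coordinates `u` of a curve and the coefficients `a` of a field along it with respect to a
frame satisfy the geodesic equation, then the curve is a geodesic with velocity `∑ aᵢ Yᵢ`. -/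
theorem isGeodesicOn_of_frame [I'.Boundaryless] {r : ℕ} {y : N} {U : Set N} (hU : IsOpen U)
    {Y : Fin r → Π z : N, TangentSpace I' z}
    (hY : ∀ i, ContMDiffOn I' I'.tangent ∞ (T% (Y i)) U)
    (hon : ∀ z ∈ U, Orthonormal ℝ (fun i ↦ Y i z) ∧
      Submodule.span ℝ (Set.range fun i ↦ Y i z) = ⊤)
    {J : Set ℝ} (hJ : IsOpen J) {u : ℝ → E'} {a : Fin r → ℝ → ℝ}
    (hu : ContDiffOn ℝ ∞ u J)
    (ht : ∀ t ∈ J, u t ∈ (extChartAt I' y).target ∧ (extChartAt I' y).symm (u t) ∈ U)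
    (hu' : ∀ t ∈ J, HasDerivAt u (∑ i, a i t • (trivializationAt E' (TangentSpace I' : N → Type _) y
      ⟨(extChartAt I' y).symm (u t), Y i ((extChartAt I' y).symm (u t))⟩).2) t)
    (ha' : ∀ t ∈ J, ∀ k, HasDerivAt (a k) (-∑ i, ∑ j, a i t * a j t *
      inner ℝ (leviCivita I' N (Y j) ((extChartAt I' y).symm (u t))
        (Y i ((extChartAt I' y).symm (u t)))) (Y k ((extChartAt I' y).symm (u t)))) t) :
    IsGeodesicOn I' (fun t ↦ (extChartAt I' y).symm (u t)) J ∧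
      ∀ t ∈ J, velocity I' (fun t ↦ (extChartAt I' y).symm (u t)) t =
        ∑ i, a i t • Y i ((extChartAt I' y).symm (u t)) := by
  set φ := extChartAt I' y
  have hsm : ContMDiffOn 𝓘(ℝ, ℝ) I' ∞ (fun t ↦ φ.symm (u t)) J :=
    (contMDiffOn_extChartAt_symm y).comp hu.contMDiffOn fun t h ↦ (ht t h).1
  have hvel (t : ℝ) (h : t ∈ J) : velocity I' (fun t ↦ φ.symm (u t)) t =
      ∑ i, a i t • Y i (φ.symm (u t)) := by
    have hz : φ.symm (u t) ∈ (chartAt H' y).source := by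
      rw [← extChartAt_source I']
      exact φ.map_target (ht t h).1
    have hb : φ.symm (u t) ∈ (trivializationAt E' (TangentSpace I' : N → Type _) y).baseSet := hz
    have d1 : MDifferentiableAt 𝓘(ℝ, E') I' φ.symm (u t) := by
      have := mdifferentiableWithinAt_extChartAt_symm (I := I') (ht t h).1
      rwa [I'.range_eq_univ, mdifferentiableWithinAt_univ] at this
    have h1 := mfderiv_comp_apply t d1 (hu' t h).differentiableAt.mdifferentiableAt (1 : ℝ)
    have h2 : mfderiv 𝓘(ℝ, ℝ) 𝓘(ℝ, E') u t (1 : ℝ) = ∑ i, a i t •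
        (trivializationAt E' (TangentSpace I' : N → Type _) y
          ⟨φ.symm (u t), Y i (φ.symm (u t))⟩).2 := by
      rw [mfderiv_eq_fderiv]
      exact (fderiv_apply_one_eq_deriv (f := u)).trans (hu' t h).deriv
    have h3 := TangentBundle.symmL_trivializationAt (I := I') hz
    rw [I'.range_eq_univ, mfderivWithin_univ, φ.right_inv (ht t h).1] at h3
    refine h1.trans ((congrArg _ h2).trans ?_)
    refine (congrArg (fun A : E' →L[ℝ] TangentSpace I' (φ.symm (u t)) ↦ A _) h3).symm.trans ?_
    rw [map_sum]
    refine Finset.sum_congr rfl fun i _ ↦ ?_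
    rw [map_smul]
    congr 1
    have h4 := Trivialization.symmL_continuousLinearMapAt (R := ℝ) _ hb (Y i (φ.symm (u t)))
    rwa [Trivialization.continuousLinearMapAt_apply, Trivialization.linearMapAt_apply, if_pos hb]
      at h4
  refine ⟨⟨hsm, fun t h ↦ ?_⟩, hvel⟩
  have hβ : MDifferentiableAt 𝓘(ℝ, ℝ) I' (fun t ↦ φ.symm (u t)) t :=
    (hsm.contMDiffAt (hJ.mem_nhds h)).mdifferentiableAt (by simp)
  have hcong : ∀ᶠ s in 𝓝 t, velocity I' (fun t ↦ φ.symm (u t)) s =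
      ∑ i, a i s • Y i (φ.symm (u s)) := by
    filter_upwards [hJ.mem_nhds h] with s hs using hvel s hs
  -- `e` is the number `1` regarded as a tangent vector of the line.
  obtain ⟨e, he⟩ : ∃ e : TangentSpace 𝓘(ℝ, ℝ) t, e = (1 : ℝ) := ⟨_, rfl⟩
  have hv : mfderiv 𝓘(ℝ, ℝ) I' (fun t ↦ φ.symm (u t)) t e =
      ∑ i, a i t • Y i (φ.symm (u t)) := he ▸ hvel t h
  have hd (i : Fin r) : mvfderiv 𝓘(ℝ, ℝ) (a i) t e = deriv (a i) t := by
    rw [← fderiv_apply_one_eq_deriv, mvfderiv, mfderiv_eq_fderiv, he]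
    rfl
  refine Eq.trans (congrArg _ he.symm) ?_
  rw [pullbackCov_congr hcong, pullbackCov_sum_smul_comp Finset.univ hβ
    (fun i _ ↦ (ha' t h i).differentiableAt.mdifferentiableAt)
    fun i _ ↦ (hY i).mdiffAt_section hU (ht t h).2, hv]
  have hon' := hon _ (ht t h).2
  have hz (w : TangentSpace I' (φ.symm (u t)))
      (hw : ∀ k, inner ℝ (Y k (φ.symm (u t))) w = 0) : w = 0 := by
    have : w ∈ (Submodule.span ℝ (Set.range fun i ↦ Y i (φ.symm (u t))))ᗮ := by
      rw [Submodule.mem_orthogonal]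
      intro x hx
      induction hx using Submodule.span_induction with
      | mem x hx => obtain ⟨k, rfl⟩ := hx; exact hw k
      | zero => simp
      | add x x' _ _ h1 h2 => rw [inner_add_left, h1, h2, add_zero]
      | smul c x _ h1 => rw [inner_smul_left, h1, mul_zero]
    rwa [hon'.2, Submodule.top_orthogonal_eq_bot, Submodule.mem_bot] at this
  -- The `Y k` component of `∇_{β'} β'` is `a_k' + ∑ a_i a_j ⟨∇_{Y i} Y j, Y k⟩`, which is zero by
  -- the equation for `a_k`.
  refine hz _ fun k ↦ ?_
  simp only [map_sum, map_smul, inner_sum, inner_add_right, inner_smul_right, hd,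
    (ha' t h _).deriv, Finset.sum_add_distrib, orthonormal_iff_ite.1 hon'.1 k, mul_ite, mul_one,
    mul_zero, Finset.sum_ite_eq, Finset.mem_univ, if_true]
  rw [← sub_eq_add_neg, sub_eq_zero, Finset.sum_comm]
  simp only [Finset.mul_sum]
  refine Finset.sum_congr rfl fun i _ ↦ Finset.sum_congr rfl fun j _ ↦ ?_
  rw [real_inner_comm]
  ring

end Geodesics

/-! ### Existence of geodesics -/

section GeodesicExistence

variable {E' : Type*} [NormedAddCommGroup E'] [NormedSpace ℝ E'] [FiniteDimensional ℝ E']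
  {H' : Type*} [TopologicalSpace H'] {I' : ModelWithCorners ℝ E' H'}
  {N : Type*} [TopologicalSpace N] [ChartedSpace H' N] [IsManifold I' ∞ N]
  [RiemannianBundle (fun y : N ↦ TangentSpace I' y)]
  [IsContMDiffRiemannianBundle I' ∞ E' (fun y : N ↦ TangentSpace I' y)]

theorem sum_inner_smul_of_orthonormal_of_span {V : Type*} [NormedAddCommGroup V]
    [InnerProductSpace ℝ V] {r : ℕ} {e : Fin r → V} (he : Orthonormal ℝ e) {v : V}
    (hv : v ∈ Submodule.span ℝ (Set.range e)) : ∑ i, inner ℝ (e i) v • e i = v := by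
  induction hv using Submodule.span_induction with
  | mem x hx =>
    obtain ⟨k, rfl⟩ := hx
    simp [orthonormal_iff_ite.1 he]
  | zero => simp
  | add x y _ _ hx hy =>
    simp only [inner_add_right, add_smul, Finset.sum_add_distrib, hx, hy]
  | smul c x _ hx =>
    simp only [inner_smul_right, mul_smul, ← Finset.smul_sum, hx]

/-- Through every tangent vector there is a geodesic, which can be kept in a given open set. -/
theorem exists_isGeodesicOn [I'.Boundaryless] {W : Set N} (hW : IsOpen W) {y : N} (hy : y ∈ W)
    (v : TangentSpace I' y) : ∃ (β : ℝ → N) (ε : ℝ), 0 < ε ∧ IsGeodesicOn I' β (Ioo (-ε) ε) ∧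
      MapsTo β (Ioo (-ε) ε) W ∧
      (⟨β 0, velocity I' β 0⟩ : TangentBundle I' N) = ⟨y, v⟩ := by
  obtain ⟨U₀, hU₀, hyU₀, Y, hY₀, hon₀⟩ := exists_orthonormal_frame_tangent (I' := I') y
  -- A domain on which the frame, a single chart and the constraint set `W` are all available.
  set U := U₀ ∩ (W ∩ (chartAt H' y).source)
  have hU : IsOpen U := hU₀.inter (hW.inter (chartAt H' y).open_source)
  have hyU : y ∈ U := ⟨hyU₀, hy, mem_chart_source H' y⟩
  have hY (i) : ContMDiffOn I' I'.tangent ∞ (T% (Y i)) U := (hY₀ i).mono inter_subset_left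
  have hon (z) (hz : z ∈ U) := hon₀ z hz.1
  set φ := extChartAt I' y
  set S : Set E' := φ.target ∩ φ.symm ⁻¹' U
  have hS : IsOpen S := (continuousOn_extChartAt_symm y).isOpen_inter_preimage
    (isOpen_extChartAt_target y) hU
  have hφ : ContMDiffOn 𝓘(ℝ, E') I' ∞ φ.symm S := (contMDiffOn_extChartAt_symm y).mono
    inter_subset_left
  let X (i) (u : E') : E' :=
    (trivializationAt E' (TangentSpace I' : N → Type _) y ⟨φ.symm u, Y i (φ.symm u)⟩).2
  have hX (i) : ContDiffOn ℝ ∞ (X i) S := by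
    have h := (Trivialization.contMDiffOn_section_iff
      (trivializationAt E' (TangentSpace I' : N → Type _) y) hU fun z hz ↦ hz.2.2).1 (hY i)
    exact (h.comp hφ fun u hu ↦ hu.2).contDiffOn
  let Γ (i j k) (u : E') : ℝ :=
    inner ℝ (leviCivita I' N (Y j) (φ.symm u) (Y i (φ.symm u))) (Y k (φ.symm u))
  have hΓ (i j k) : ContDiffOn ℝ ∞ (Γ i j k) S :=
    ((contMDiffOn_inner_leviCivita_of_orthonormal hU hY (fun z hz ↦ (hon z hz).1) i j k).comp hφ
      fun u hu ↦ hu.2).contDiffOn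
  -- The geodesic equation as a first-order autonomous system: chart coordinates of the point, and
  -- frame coefficients of the velocity.
  let f : E' × (Fin (finrank ℝ E') → ℝ) → E' × (Fin (finrank ℝ E') → ℝ) := fun x ↦
    (∑ i, x.2 i • X i x.1, fun k ↦ -∑ i, ∑ j, x.2 i * x.2 j * Γ i j k x.1)
  have h1 : ContDiffOn ℝ ∞ (fun x : E' × (Fin (finrank ℝ E') → ℝ) ↦ x.1) (S ×ˢ univ) :=
    contDiff_fst.contDiffOn
  have h2 (i) : ContDiffOn ℝ ∞ (fun x : E' × (Fin (finrank ℝ E') → ℝ) ↦ x.2 i) (S ×ˢ univ) :=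
    ((contDiff_apply ℝ ℝ i).comp contDiff_snd).contDiffOn
  have hm : MapsTo (fun x : E' × (Fin (finrank ℝ E') → ℝ) ↦ x.1) (S ×ˢ univ) S := fun x hx ↦ hx.1
  have hf : ContDiffOn ℝ ∞ f (S ×ˢ univ) := by
    refine ContDiffOn.prodMk (.sum fun i _ ↦ (h2 i).smul ((hX i).comp h1 hm)) ?_
    exact contDiffOn_pi.2 fun k ↦ (ContDiffOn.sum fun i _ ↦ ContDiffOn.sum fun j _ ↦
      ((h2 i).mul (h2 j)).mul ((hΓ i j k).comp h1 hm)).neg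
  let x₀ : E' × (Fin (finrank ℝ E') → ℝ) := (φ y, fun i ↦ inner ℝ (Y i y) v)
  have hy' : φ.symm (φ y) = y := extChartAt_to_inv y
  have hx₀ : x₀ ∈ S ×ˢ (univ : Set (Fin (finrank ℝ E') → ℝ)) :=
    ⟨⟨mem_extChartAt_target y, by rw [mem_preimage, hy']; exact hyU⟩, mem_univ _⟩
  have hSo : IsOpen (S ×ˢ (univ : Set (Fin (finrank ℝ E') → ℝ))) := hS.prod isOpen_univ
  obtain ⟨α, hα0, ε, hε, hα⟩ := ((hf.contDiffAt (hSo.mem_nhds hx₀)).of_le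
    (m := 1) (by simp)).exists_forall_mem_closedBall_exists_eq_forall_mem_Ioo_hasDerivAt₀ 0
  have hcont : ContinuousAt α 0 := (hα 0 (by simp [hε])).continuousAt
  have hev : ∀ᶠ t in 𝓝 (0 : ℝ), α t ∈ S ×ˢ (univ : Set (Fin (finrank ℝ E') → ℝ)) :=
    hcont (hSo.mem_nhds (by rwa [hα0]))
  obtain ⟨δ, hδ, hball⟩ := Metric.eventually_nhds_iff_ball.1 hev
  set η := min ε δ
  have hη : 0 < η := lt_min hε hδ
  have hα' (t : ℝ) (ht : t ∈ Ioo (-η) η) : HasDerivAt α (f (α t)) t :=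
    hα t ⟨by linarith [ht.1, min_le_left ε δ], by linarith [ht.2, min_le_left ε δ]⟩
  have hαS (t : ℝ) (ht : t ∈ Ioo (-η) η) :
      α t ∈ S ×ˢ (univ : Set (Fin (finrank ℝ E') → ℝ)) :=
    hball t (by
      rw [Metric.mem_ball, Real.dist_0_eq_abs, abs_lt]
      exact ⟨by linarith [ht.1, min_le_right ε δ], by linarith [ht.2, min_le_right ε δ]⟩)
  have hsm : ContDiffOn ℝ ∞ α (Ioo (-η) η) :=
    contDiffOn_of_hasDerivAt_autonomous hf isOpen_Ioo hα' hαS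
  obtain ⟨hg, hv⟩ := isGeodesicOn_of_frame hU hY hon isOpen_Ioo (u := fun t ↦ (α t).1)
    (a := fun i t ↦ (α t).2 i) (contDiff_fst.comp_contDiffOn hsm)
    (fun t ht ↦ (hαS t ht).1)
    (fun t ht ↦ (hα' t ht).fst)
    (fun t ht k ↦ hasDerivAt_pi.1 (hα' t ht).snd k)
  refine ⟨fun t ↦ φ.symm (α t).1, η, hη, hg, fun t ht ↦ (hαS t ht).1.2.2.1, ?_⟩
  rw [hv 0 (by simp [hη])]
  have h4 (i) : (α 0).2 i = inner ℝ (Y i y) v := by rw [hα0]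
  simp only [h4]
  have h3 : ∑ i, inner ℝ (Y i y) v • Y i y = v :=
    sum_inner_smul_of_orthonormal_of_span (hon y hyU).1 (by rw [(hon y hyU).2]; trivial)
  -- The curve starts at `φ.symm (φ y)`, which is only provably equal to `y`; the velocities are
  -- therefore compared as points of the tangent bundle.
  have key (z : N) (hz : z = y) : (⟨z, ∑ i, inner ℝ (Y i y) v • Y i z⟩ : TangentBundle I' N) =
      ⟨y, v⟩ := by
    subst hz
    rw [h3]
  exact key _ (by rw [hα0]; exact hy')

end GeodesicExistence

/-! ### Differentiating Clairaut's relation -/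

/-- Pythagoras: `|v| |cos ω|` is the length of the component in `Kᗮ`. If that component is zero, the
angle is `π / 2` by convention and the formula persists. Squaring the Clairaut relation thus removes
the angle. -/
theorem norm_sq_mul_sin_sq_angle_starProjection {V : Type*} [NormedAddCommGroup V]
    [InnerProductSpace ℝ V] (K : Submodule ℝ V) [K.HasOrthogonalProjection] (v : V) :
    ‖v‖ ^ 2 * Real.sin (InnerProductGeometry.angle v (Kᗮ.starProjection v)) ^ 2 =
      ‖K.starProjection v‖ ^ 2 := by
  have h1 := K.norm_sq_eq_add_norm_sq_starProjection v
  have h2 : inner ℝ v (Kᗮ.starProjection v) = ‖Kᗮ.starProjection v‖ ^ 2 := by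
    rw [← real_inner_self_eq_norm_sq, Submodule.inner_starProjection_left_eq_right,
      Submodule.starProjection_eq_self_iff.2 (Submodule.starProjection_apply_mem _ _)]
  have h3 := InnerProductGeometry.cos_angle_mul_norm_mul_norm v (Kᗮ.starProjection v)
  rw [h2] at h3
  have h4 : (Real.cos (InnerProductGeometry.angle v (Kᗮ.starProjection v)) * ‖v‖) ^ 2 =
      ‖Kᗮ.starProjection v‖ ^ 2 := by
    by_cases h0 : Kᗮ.starProjection v = 0
    · rw [h0, InnerProductGeometry.angle_zero_right]
      simp
    · have : ‖Kᗮ.starProjection v‖ ≠ 0 := norm_ne_zero_iff.2 h0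
      congr 1
      apply mul_right_cancel₀ this
      linear_combination h3
  rw [Real.sin_sq]
  linear_combination h1 - h4

theorem norm_sq_starProjection_of_orthonormal {V : Type*} [NormedAddCommGroup V]
    [InnerProductSpace ℝ V] {K : Submodule ℝ V} [K.HasOrthogonalProjection] {r : ℕ} {e : Fin r → V}
    (he : Orthonormal ℝ e) (hK : Submodule.span ℝ (Set.range e) = K) (v : V) :
    ‖K.starProjection v‖ ^ 2 = ∑ i, inner ℝ (e i) v ^ 2 := by
  have hi (i) : inner ℝ (e i) (K.starProjection v) = inner ℝ (e i) v := by
    rw [← Submodule.inner_starProjection_left_eq_right, Submodule.starProjection_eq_self_iff.2]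
    exact hK ▸ Submodule.subset_span ⟨i, rfl⟩
  have h := sum_inner_smul_of_orthonormal_of_span he (v := K.starProjection v)
    (by rw [hK]; exact Submodule.starProjection_apply_mem _ _)
  rw [← real_inner_self_eq_norm_sq]
  nth_rewrite 1 [← h]
  simp only [sum_inner, inner_smul_left, hi, conj_trivial, pow_two]

theorem MDifferentiableAt.hasDerivAt_mvfderiv {f : ℝ → ℝ} {t : ℝ}
    (hf : MDifferentiableAt 𝓘(ℝ, ℝ) 𝓘(ℝ, ℝ) f t) {e : TangentSpace 𝓘(ℝ, ℝ) t} (he : e = (1 : ℝ)) :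
    HasDerivAt f (mvfderiv 𝓘(ℝ, ℝ) f t e) t := by
  have h : mvfderiv 𝓘(ℝ, ℝ) f t e = deriv f t := by
    rw [← fderiv_apply_one_eq_deriv, mvfderiv, mfderiv_eq_fderiv, he]
    rfl
  rw [h]
  exact hf.differentiableAt.hasDerivAt

section Clairaut

variable {E' : Type*} [NormedAddCommGroup E'] [NormedSpace ℝ E'] [FiniteDimensional ℝ E']
  {H' : Type*} [TopologicalSpace H'] {I' : ModelWithCorners ℝ E' H'}
  {N : Type*} [TopologicalSpace N] [ChartedSpace H' N] [IsManifold I' ∞ N]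
  [RiemannianBundle (fun y : N ↦ TangentSpace I' y)]
  [IsContMDiffRiemannianBundle I' ∞ E' (fun y : N ↦ TangentSpace I' y)]
  {D : Π y : N, Submodule ℝ (TangentSpace I' y)} {W U : Set N} {g : N → ℝ}
  {r : ℕ} {X : Fin r → Π z : N, TangentSpace I' z}

/-- The derivative of Clairaut's relation along a geodesic with initial velocity `v`. -/
theorem clairaut_deriv [I'.Boundaryless] (hg : ContMDiff I' 𝓘(ℝ, ℝ) ∞ g)
    (hC : ClairautRelation D W (fun y ↦ Real.exp (g y)))
    (hU : IsOpen U) (hUW : U ⊆ W) (hX : ∀ i, ContMDiffOn I' I'.tangent ∞ (T% (X i)) U)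
    (hon : ∀ z ∈ U, Orthonormal ℝ (fun i ↦ X i z) ∧
      Submodule.span ℝ (Set.range fun i ↦ X i z) = D z) {y : N} (hy : y ∈ U)
    (v : TangentSpace I' y) :
    mvfderiv I' g y v * ∑ i, inner ℝ (X i y) v ^ 2 +
      ∑ i, inner ℝ (X i y) v * inner ℝ (leviCivita I' N (X i) y v) v = 0 := by
  obtain ⟨β, ε, hε, hβ, hβU, hv⟩ := exists_isGeodesicOn hU hy v
  obtain ⟨c, hc⟩ := hC.2 _ β isOpen_Ioo ordConnected_Ioo hβ (hβU.mono_right hUW)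
  have h0 : (0 : ℝ) ∈ Ioo (-ε) ε := by simp [hε]
  -- The identity is proved at `β 0` and then transported along the equality of `(β 0, β' 0)` with
  -- `(y, v)` in the tangent bundle.
  suffices H : mvfderiv I' g (β 0) (velocity I' β 0) *
      ∑ i, inner ℝ (X i (β 0)) (velocity I' β 0) ^ 2 +
      ∑ i, inner ℝ (X i (β 0)) (velocity I' β 0) *
        inner ℝ (leviCivita I' N (X i) (β 0) (velocity I' β 0)) (velocity I' β 0) = 0 by
    have key (w : TangentBundle I' N) (hw : w = ⟨y, v⟩) (hH : mvfderiv I' g w.1 w.2 *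
      ∑ i, inner ℝ (X i w.1) w.2 ^ 2 +
      ∑ i, inner ℝ (X i w.1) w.2 *
        inner ℝ (leviCivita I' N (X i) w.1 w.2) w.2 = 0) : mvfderiv I' g y v *
      ∑ i, inner ℝ (X i y) v ^ 2 +
      ∑ i, inner ℝ (X i y) v * inner ℝ (leviCivita I' N (X i) y v) v = 0 := by
      subst hw
      exact hH
    exact key _ hv H
  obtain ⟨e, he⟩ : ∃ e : TangentSpace 𝓘(ℝ, ℝ) (0 : ℝ), e = (1 : ℝ) := ⟨_, rfl⟩
  have hve : mfderiv 𝓘(ℝ, ℝ) I' β 0 e = velocity I' β 0 := by rw [he]; rfl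
  have hβd : MDifferentiableAt 𝓘(ℝ, ℝ) I' β 0 :=
    (hβ.1.contMDiffAt (isOpen_Ioo.mem_nhds h0)).mdifferentiableAt (by simp)
  have hgeo : pullbackCov 𝓘(ℝ, ℝ) I' β (velocity I' β) 0 e = 0 := by
    rw [he]
    exact hβ.2 0 h0
  have hvd : MDiffAlongAt 𝓘(ℝ, ℝ) I' β (velocity I' β) 0 := by
    refine mdiffAlongAt_mfderiv_of_contMDiffOn isOpen_Ioo h0 hβ.1
      (Y := fun t ↦ (1 : ℝ)) ?_
    refine (mdifferentiableAt_section (F := ℝ) (E := TangentSpace 𝓘(ℝ, ℝ)) 𝓘(ℝ, ℝ)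
      (fun _ ↦ (1 : ℝ))).2 ?_
    simp only [trivializationAt_model_space_apply]
    exact mdifferentiableAt_const
  have hXd (i) : MDiffAt (T% (X i)) (β 0) := (hX i).mdiffAt_section hU (hβU h0)
  have hXβ (i) : MDiffAlongAt 𝓘(ℝ, ℝ) I' β (fun t ↦ X i (β t)) 0 := .comp hβd (hXd i)
  have dg : HasDerivAt (fun t ↦ g (β t)) (mvfderiv I' g (β 0) (velocity I' β 0)) 0 := by
    have hgd : MDifferentiableAt I' 𝓘(ℝ, ℝ) g (β 0) := hg.mdifferentiableAt (by simp)
    have h1 := (hgd.comp (0 : ℝ) hβd).hasDerivAt_mvfderiv he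
    rwa [mvfderiv_comp_apply _ hgd hβd, hve] at h1
  have dX (i) : HasDerivAt (fun t ↦ inner ℝ (X i (β t)) (velocity I' β t))
      (inner ℝ (leviCivita I' N (X i) (β 0) (velocity I' β 0)) (velocity I' β 0)) 0 := by
    have h1 := ((hXβ i).inner hvd).hasDerivAt_mvfderiv he
    rwa [mvfderiv_inner_along (hXβ i) hvd, pullbackCov_comp hβd (hXd i), hgeo, inner_zero_right,
      add_zero, hve] at h1
  -- The squared speed is stationary because `∇_{β'} β' = 0`.
  have dv : HasDerivAt (fun t ↦ inner ℝ (velocity I' β t) (velocity I' β t)) 0 0 := by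
    have h1 := (hvd.inner hvd).hasDerivAt_mvfderiv he
    rwa [mvfderiv_inner_along hvd hvd, hgeo, inner_zero_right, inner_zero_left, add_zero] at h1
  -- Clairaut's relation squared and multiplied by `|β'|²`, with the `D` component of `β'` expanded
  -- in the frame. Differentiating at `0` and cancelling `2 e^{2g}` gives the claim.
  have heq : (fun t ↦ Real.exp (g (β t)) ^ 2 *
      ∑ i, inner ℝ (X i (β t)) (velocity I' β t) ^ 2) =ᶠ[𝓝 0]
      fun t ↦ c ^ 2 * inner ℝ (velocity I' β t) (velocity I' β t) := by
    filter_upwards [isOpen_Ioo.mem_nhds h0] with t ht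
    have ho := hon _ (hβU ht)
    rw [← norm_sq_starProjection_of_orthonormal ho.1 ho.2,
      ← norm_sq_mul_sin_sq_angle_starProjection, ← hc t ht, real_inner_self_eq_norm_sq,
      clairautAngle]
    ring
  have d1 := (dg.exp.pow 2).mul (HasDerivAt.fun_sum fun i (_ : i ∈ Finset.univ) ↦ (dX i).pow 2)
  have d2 := (dv.const_mul (c ^ 2)).congr_of_eventuallyEq heq
  have h2 : ((2 : ℕ) : ℝ) * Real.exp (g (β 0)) ^ (2 - 1) *
      (Real.exp (g (β 0)) * mvfderiv I' g (β 0) (velocity I' β 0)) *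
      ∑ i, inner ℝ (X i (β 0)) (velocity I' β 0) ^ 2 + Real.exp (g (β 0)) ^ 2 *
      ∑ i, ((2 : ℕ) : ℝ) * inner ℝ (X i (β 0)) (velocity I' β 0) ^ (2 - 1) *
        inner ℝ (leviCivita I' N (X i) (β 0) (velocity I' β 0)) (velocity I' β 0) = c ^ 2 * 0 :=
    d1.unique d2
  have hexp : Real.exp (g (β 0)) ≠ 0 := (Real.exp_pos _).ne'
  have h3 : (2 * Real.exp (g (β 0)) ^ 2) * (mvfderiv I' g (β 0) (velocity I' β 0) *
      ∑ i, inner ℝ (X i (β 0)) (velocity I' β 0) ^ 2 +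
      ∑ i, inner ℝ (X i (β 0)) (velocity I' β 0) *
        inner ℝ (leviCivita I' N (X i) (β 0) (velocity I' β 0)) (velocity I' β 0)) = 0 := by
    simp only [Nat.cast_ofNat, Nat.add_one_sub_one, pow_one, mul_zero] at h2
    simp only [mul_assoc, ← Finset.mul_sum] at h2
    linear_combination h2
  exact (mul_eq_zero.1 h3).resolve_left (mul_ne_zero two_ne_zero (pow_ne_zero 2 hexp))

end Clairaut

/-! ### The second fundamental form of a distribution -/

section DistributionFrames

variable {E' : Type*} [NormedAddCommGroup E'] [NormedSpace ℝ E'] [FiniteDimensional ℝ E']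
  {H' : Type*} [TopologicalSpace H'] {I' : ModelWithCorners ℝ E' H'}
  {N : Type*} [TopologicalSpace N] [ChartedSpace H' N] [IsManifold I' ∞ N]
  [RiemannianBundle (fun y : N ↦ TangentSpace I' y)]
  [IsContMDiffRiemannianBundle I' ∞ E' (fun y : N ↦ TangentSpace I' y)]
  {D : Π y : N, Submodule ℝ (TangentSpace I' y)} {W U : Set N} {g : N → ℝ}
  {r : ℕ} {X : Fin r → Π z : N, TangentSpace I' z}

/-- The derivative `∇_w (∑ ⟨Xᵢ, h⟩ Xᵢ)`, the coefficients being frozen at `y`. -/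
noncomputable def frameDeriv (X : Fin r → Π z : N, TangentSpace I' z) (y : N)
    (w h : TangentSpace I' y) : TangentSpace I' y :=
  ∑ i, (inner ℝ (X i y) h : ℝ) • leviCivita I' N (X i) y w

theorem frameDeriv_add_left (y : N) (w w' h : TangentSpace I' y) :
    frameDeriv X y (w + w') h = frameDeriv X y w h + frameDeriv X y w' h := by
  simp only [frameDeriv, map_add, smul_add, Finset.sum_add_distrib]

theorem frameDeriv_add_right (y : N) (w h h' : TangentSpace I' y) :
    frameDeriv X y w (h + h') = frameDeriv X y w h + frameDeriv X y w h' := by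
  simp only [frameDeriv, inner_add_right, add_smul, Finset.sum_add_distrib]

theorem leviCivita_sum_const_smul {y : N} (hX : ∀ i, MDiffAt (T% (X i)) y)
    (w h : TangentSpace I' y) :
    leviCivita I' N (fun z ↦ ∑ i, (inner ℝ (X i y) h : ℝ) • X i z) y w = frameDeriv X y w h := by
  rw [leviCivita_sum_smul Finset.univ (f := fun i _ ↦ (inner ℝ (X i y) h : ℝ))
    (fun i _ ↦ mdifferentiableAt_const) fun i _ ↦ hX i]
  simp only [mvfderiv_const, zero_apply, zero_smul, add_zero, frameDeriv]

theorem leviCivita_inner_add_inner_eq_zero (hU : IsOpen U) {Y Z : Π z : N, TangentSpace I' z}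
    (hY : ContMDiffOn I' I'.tangent ∞ (T% Y) U) (hZ : ContMDiffOn I' I'.tangent ∞ (T% Z) U) {c : ℝ}
    (hc : ∀ z ∈ U, inner ℝ (Y z) (Z z) = c) {y : N} (hy : y ∈ U) (w : TangentSpace I' y) :
    inner ℝ (leviCivita I' N Y y w) (Z y) + inner ℝ (Y y) (leviCivita I' N Z y w) = 0 := by
  have h := leviCivita_metric (mdifferentiableAt_extend I' E' w) (hY.mdiffAt_section hU hy)
    (hZ.mdiffAt_section hU hy)
  simp only [extend_apply_self] at h
  rw [← h]
  have hcc : (fun z ↦ inner ℝ (Y z) (Z z)) =ᶠ[𝓝 y] fun _ ↦ c := by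
    filter_upwards [hU.mem_nhds hy] with z hz using hc z hz
  have h1 := hcc.mfderiv_eq (I := I') (I' := 𝓘(ℝ, ℝ))
  rw [mfderiv_const] at h1
  exact congrArg (fun A : TangentSpace I' y →L[ℝ] ℝ ↦ A w) h1

variable (hU : IsOpen U) (hX : ∀ i, ContMDiffOn I' I'.tangent ∞ (T% (X i)) U)
    (hon : ∀ z ∈ U, Orthonormal ℝ (fun i ↦ X i z) ∧
      Submodule.span ℝ (Set.range fun i ↦ X i z) = D z) {y : N} (hy : y ∈ U)

include hU hX hon hy

/-- The combination of the frame with coefficients frozen at `y` has constant length and value `h`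
at `y`, so its derivative is orthogonal to `h`. -/
theorem inner_frameDeriv_self (w h : TangentSpace I' y) (hh : h ∈ D y) :
    inner ℝ (frameDeriv X y w h) h = 0 := by
  have hs : ContMDiffOn I' I'.tangent ∞
      (T% (fun z ↦ ∑ i, (inner ℝ (X i y) h : ℝ) • X i z)) U :=
    .sum_section fun i _ ↦ ContMDiffOn.smul_section contMDiffOn_const (hX i)
  have h1 := leviCivita_inner_add_inner_eq_zero hU hs hs
    (c := ∑ i, inner ℝ (X i y) h * inner ℝ (X i y) h) (fun z hz ↦ by
      simp only [sum_inner, inner_sum, inner_smul_left, inner_smul_right, conj_trivial, mul_ite,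
        mul_one, mul_zero, orthonormal_iff_ite.1 (hon z hz).1, Finset.sum_ite_eq',
        Finset.mem_univ, if_true]) hy w
  rw [leviCivita_sum_const_smul fun i ↦ (hX i).mdiffAt_section hU hy,
    sum_inner_smul_of_orthonormal_of_span (hon y hy).1 (by rwa [(hon y hy).2])] at h1
  linarith [real_inner_comm h (frameDeriv X y w h)]

/-- Extend `V` to a section `Z` of `Dᗮ`. Since `⟨X i, Z⟩ = 0`, differentiation gives `⟨∇_V (X i), V⟩
= -⟨X i, ∇_V Z⟩`, which vanishes because `∇_V Z` lies in `Dᗮ`. -/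
theorem inner_frameDeriv_of_totallyGeodesic (hUW : U ⊆ W)
    (hperp : IsTotallyGeodesicOn (fun y ↦ (D y)ᗮ) W) (V h : TangentSpace I' y) (hV : V ∈ (D y)ᗮ) :
    inner ℝ (frameDeriv X y V h) V = 0 := by
  obtain ⟨s, hs, hVs⟩ := exists_contMDiffOn_extend I' E' V (k := ∞)
  obtain ⟨t, hts, ht, hyt⟩ := mem_nhds_iff.1 hs
  have hUt : IsOpen (U ∩ t) := hU.inter ht
  have hX' (i) := (hX i).mono (inter_subset_left (t := t))
  have hE := hVs.mono (inter_subset_right.trans hts : U ∩ t ⊆ s)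
  -- The chart-constant extension of `V` with its `D` component removed; at `y` nothing is removed.
  let Z : Π z : N, TangentSpace I' z := fun z ↦
    extend E' V z - ∑ i, (inner ℝ (X i z) (extend E' V z) : ℝ) • X i z
  have hZ : ContMDiffOn I' I'.tangent ∞ (T% Z) (U ∩ t) :=
    hE.sub_section (.sum_section fun i _ ↦
      (contMDiffOn_inner_tangent (hX' i) hE).smul_section (hX' i))
  have hXD (i) (z) (hz : z ∈ U) : X i z ∈ D z :=
    (hon z hz).2 ▸ Submodule.subset_span ⟨i, rfl⟩
  have hXZ (i) (z) (hz : z ∈ U ∩ t) : inner ℝ (X i z) (Z z) = 0 := by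
    simp [Z, inner_sub_right, inner_sum, inner_smul_right, orthonormal_iff_ite.1 (hon z hz.1).1]
  have hZD (z) (hz : z ∈ U ∩ t) : Z z ∈ (D z)ᗮ := by
    rw [Submodule.mem_orthogonal, ← (hon z hz.1).2]
    intro x hx
    induction hx using Submodule.span_induction with
    | mem x hx => obtain ⟨k, rfl⟩ := hx; exact hXZ k z hz
    | zero => simp
    | add x x' _ _ h1 h2 => rw [inner_add_left, h1, h2, add_zero]
    | smul c x _ h1 => rw [inner_smul_left, h1, mul_zero]
  have hZy : Z y = V := by
    have hi (i) : inner ℝ (X i y) V = 0 := hV _ (hXD i y hy)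
    simp [Z, hi]
  have hyUt : y ∈ U ∩ t := ⟨hy, hyt⟩
  have htg := hperp (U ∩ t) hUt (inter_subset_left.trans hUW) Z Z hZ hZ hZD hZD y hyUt
  rw [hZy] at htg
  rw [frameDeriv, sum_inner]
  refine Finset.sum_eq_zero fun i _ ↦ ?_
  have h1 := leviCivita_inner_add_inner_eq_zero hUt (hX' i) hZ (hXZ i) hyUt V
  rw [hZy, htg _ (hXD i y hy), add_zero] at h1
  rw [inner_smul_left, h1, mul_zero]

/-- Clairaut's relation determines the symmetric part of the second fundamental form. -/
theorem inner_frameDeriv_of_clairaut [I'.Boundaryless] (hUW : U ⊆ W)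
    (hperp : IsTotallyGeodesicOn (fun y ↦ (D y)ᗮ) W)
    (hg : ContMDiff I' 𝓘(ℝ, ℝ) ∞ g) (hC : ClairautRelation D W (fun y ↦ Real.exp (g y)))
    (h V : TangentSpace I' y) (hh : h ∈ D y) (hV : V ∈ (D y)ᗮ) :
    inner ℝ (frameDeriv X y h h) V = -(mvfderiv I' g y V * ‖h‖ ^ 2) := by
  have key (V : TangentSpace I' y) (hV : V ∈ (D y)ᗮ) :
      mvfderiv I' g y (h + V) * ‖h‖ ^ 2 + inner ℝ (frameDeriv X y h h) V = 0 := by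
    have hc (i) : inner ℝ (X i y) (h + V) = inner ℝ (X i y) h := by
      rw [inner_add_right, hV (X i y) ((hon y hy).2 ▸ Submodule.subset_span ⟨i, rfl⟩), add_zero]
    have h1 := clairaut_deriv hg hC hU hUW hX hon hy (h + V)
    have h2 : ∑ i, inner ℝ (X i y) (h + V) * inner ℝ (leviCivita I' N (X i) y (h + V)) (h + V) =
        inner ℝ (frameDeriv X y (h + V) h) (h + V) := by
      rw [frameDeriv, sum_inner]
      simp only [hc, inner_smul_left, conj_trivial]
    have h3 : ∑ i, inner ℝ (X i y) (h + V) ^ 2 = ‖h‖ ^ 2 := by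
      have := norm_sq_starProjection_of_orthonormal (hon y hy).1 (hon y hy).2 h
      rw [Submodule.starProjection_eq_self_iff.2 hh] at this
      simp only [hc, this]
    rw [h2, h3, inner_add_right, inner_frameDeriv_self hU hX hon hy _ _ hh, zero_add,
      frameDeriv_add_left, inner_add_left,
      inner_frameDeriv_of_totallyGeodesic hU hX hon hy hUW hperp V h hV, add_zero] at h1
    exact h1
  -- The case `V = 0` says `dg(h) |h|² = 0`, which removes the tangential part of `dg(h + V)`.
  have h0 := key 0 (Submodule.zero_mem _)
  have h1 := key V hV
  rw [add_zero, inner_zero_right] at h0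
  rw [map_add] at h1
  linear_combination h1 - h0

/-- Modulo the distribution, the pullback connection on sections of the distribution along a map
is given by the second fundamental form. -/
theorem pullbackCov_sub_frameDeriv_mem {E : Type*} [NormedAddCommGroup E] [NormedSpace ℝ E]
    {H : Type*} [TopologicalSpace H] {I : ModelWithCorners ℝ E H}
    {M : Type*} [TopologicalSpace M] [ChartedSpace H M] {F : M → N} {p : M} (hp : F p = y)
    {σ : Π q : M, TangentSpace I' (F q)} (hσ : MDiffAlongAt I I' F σ p)
    (hσD : ∀ q, σ q ∈ D (F q)) (v : TangentSpace I p) :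
    pullbackCov I I' F σ p v - frameDeriv X (F p) (mfderiv I I' F p v) (σ p) ∈ D (F p) := by
  subst hp
  obtain ⟨hF, -⟩ := mdiffAlongAt_iff.1 hσ
  have hXd (i) : MDiffAt (T% (X i)) (F p) := (hX i).mdiffAt_section hU hy
  -- Expanding `σ` in the frame, the derivatives of the coefficients contribute only vectors of `D`.
  have heq : ∀ᶠ q in 𝓝 p, σ q = ∑ i, (inner ℝ (X i (F q)) (σ q) : ℝ) • X i (F q) := by
    filter_upwards [hF.continuousAt (hU.mem_nhds hy)] with q hq
    exact (sum_inner_smul_of_orthonormal_of_span (hon _ hq).1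
      (by rw [(hon _ hq).2]; exact hσD q)).symm
  rw [pullbackCov_congr heq, pullbackCov_sum_smul_comp Finset.univ hF
    (fun i _ ↦ (MDiffAlongAt.comp hF (hXd i)).inner hσ) fun i _ ↦ hXd i, Finset.sum_add_distrib,
    frameDeriv, add_sub_cancel_left]
  refine Submodule.sum_mem _ fun i _ ↦ Submodule.smul_mem _ _ ?_
  exact (hon _ hy).2 ▸ Submodule.subset_span ⟨i, rfl⟩

end DistributionFrames

/-! ### Linear algebra: umbilical forms on Lagrangian subspaces -/

theorem exists_mem_ne_zero_inner_eq_zero {T : Type*} [NormedAddCommGroup T] [InnerProductSpace ℝ T]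
    {K : Submodule ℝ T} (hK : 1 < finrank ℝ K) (k : T) :
    ∃ h ∈ K, h ≠ 0 ∧ inner ℝ k h = 0 := by
  have : FiniteDimensional ℝ K := FiniteDimensional.of_finrank_pos (by omega)
  have hlt : finrank ℝ ℝ < finrank ℝ K := by rwa [finrank_self]
  obtain ⟨h, hh, h0⟩ := Submodule.exists_mem_ne_zero_of_ne_bot
    (LinearMap.ker_ne_bot_of_finrank_lt (f := (innerₛₗ ℝ k).comp K.subtype) hlt)
  exact ⟨h, h.2, by simpa using h0, by simpa using hh⟩

/-- A second fundamental form on an anti-invariant Lagrangian subspace `K` which is umbilical and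
whose associated cubic form is totally symmetric takes its values in `K`, if `dim K > 1`. -/
theorem mem_of_umbilical_of_lagrangian {T : Type*} [NormedAddCommGroup T] [InnerProductSpace ℝ T]
    [FiniteDimensional ℝ T] {K : Submodule ℝ T} (hK : 1 < finrank ℝ K) {J : T →ₗ[ℝ] T}
    (hanti : K.map J ≤ Kᗮ) (hlag : (K.map J)ᗮ ⊓ Kᗮ = ⊥) {B : T → T → T} {γ : T → ℝ}
    (hBl : ∀ w w' h, B (w + w') h = B w h + B w' h) (hBr : ∀ w h h', B w (h + h') = B w h + B w h')
    (humb : ∀ h ∈ K, ∀ V ∈ Kᗮ, inner ℝ (B h h) V = -(γ V * ‖h‖ ^ 2))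
    (hsymm : ∀ h ∈ K, ∀ k ∈ K, B h k - B k h ∈ K)
    (hJ : ∀ w ∈ K, ∀ h ∈ K, ∀ k ∈ K, inner ℝ (B w h) (J k) = inner ℝ (B w k) (J h))
    {h k : T} (hh : h ∈ K) (hk : k ∈ K) : B h k ∈ K := by
  have hJK (k : T) (hk : k ∈ K) : J k ∈ Kᗮ := hanti (Submodule.mem_map_of_mem hk)
  -- Polarization; the symmetry of `B` modulo `K` suffices because `V` is orthogonal to `K`.
  have hpol (h k V : T) (hh : h ∈ K) (hk : k ∈ K) (hV : V ∈ Kᗮ) :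
      inner ℝ (B h k) V = -(γ V * inner ℝ h k) := by
    have h1 := humb (h + k) (K.add_mem hh hk) V hV
    have h2 := hV _ (hsymm h hh k hk)
    rw [hBl, hBr, hBr, inner_add_left, inner_add_left, inner_add_left, humb h hh V hV,
      humb k hk V hV, norm_add_sq_real] at h1
    rw [inner_sub_left] at h2
    linarith
  -- With `h ∈ K` nonzero and orthogonal to `k`, exchanging `h` and `k` in `⟨B h h, J k⟩` gives `⟨B
  -- h k, J h⟩`, a multiple of `⟨h, k⟩ = 0`. This is where `dim K > 1` enters.
  have hγ (k : T) (hk : k ∈ K) : γ (J k) = 0 := by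
    obtain ⟨h, hh, h0, hkh⟩ := exists_mem_ne_zero_inner_eq_zero hK k
    have h1 := hJ h hh h hh k hk
    rw [humb h hh _ (hJK k hk), hpol h k _ hh hk (hJK h hh), real_inner_comm, hkh, mul_zero,
      neg_zero, neg_eq_zero] at h1
    exact (mul_eq_zero.1 h1).resolve_right (pow_ne_zero 2 (norm_ne_zero_iff.2 h0))
  -- The normal part of `B h k` is orthogonal to `J K`, hence zero by the Lagrangian condition.
  have hmem : Kᗮ.starProjection (B h k) ∈ (K.map J)ᗮ ⊓ Kᗮ := by
    refine ⟨?_, Submodule.starProjection_apply_mem _ _⟩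
    rintro _ ⟨l, hl, rfl⟩
    rw [← Submodule.inner_starProjection_left_eq_right,
      Submodule.starProjection_eq_self_iff.2 (hJK l hl), real_inner_comm,
      hpol h k _ hh hk (hJK l hl), hγ l hl, zero_mul, neg_zero]
  rw [hlag, Submodule.mem_bot, Submodule.starProjection_apply_eq_zero_iff,
    Submodule.orthogonal_orthogonal] at hmem
  exact hmem

/-! ### Lagrangian maps into Kähler manifolds -/

section Lagrangian

variable {E : Type*} [NormedAddCommGroup E] [NormedSpace ℝ E] [FiniteDimensional ℝ E]
  {H : Type*} [TopologicalSpace H] {I : ModelWithCorners ℝ E H} [I.Boundaryless]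
  {M : Type*} [TopologicalSpace M] [ChartedSpace H M] [IsManifold I ∞ M]
  {E' : Type*} [NormedAddCommGroup E'] [NormedSpace ℝ E'] [FiniteDimensional ℝ E']
  {H' : Type*} [TopologicalSpace H'] {I' : ModelWithCorners ℝ E' H'}
  {N : Type*} [TopologicalSpace N] [ChartedSpace H' N] [IsManifold I' ∞ N]
  [RiemannianBundle (fun y : N ↦ TangentSpace I' y)]
  [IsContMDiffRiemannianBundle I' ∞ E' (fun y : N ↦ TangentSpace I' y)]
  {J : Π y : N, TangentSpace I' y →L[ℝ] TangentSpace I' y} {F : M → N}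
  {D : Π y : N, Submodule ℝ (TangentSpace I' y)} {W U : Set N} {g : N → ℝ}
  {r : ℕ} {X : Fin r → Π z : N, TangentSpace I' z}

theorem IsKahler.inner_apply_right (hJ : IsKahler J) {y : N} (v w : TangentSpace I' y) :
    inner ℝ v (J y w) = -inner ℝ (J y v) w := by
  rw [← hJ.orthogonal y v (J y w), hJ.sq, inner_neg_right]

theorem IsKahler.contMDiffOn_apply (hJ : IsKahler J) {Y : Π z : N, TangentSpace I' z}
    (hY : ContMDiffOn I' I'.tangent ∞ (T% Y) U) :
    ContMDiffOn I' I'.tangent ∞ (T% (fun z ↦ J z (Y z))) U :=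
  ContMDiffOn.clm_bundle_apply (b := id) hJ.smooth.contMDiffOn hY

omit [FiniteDimensional ℝ E] [I.Boundaryless] [IsManifold I ∞ M] in
/-- For an anti-invariant map into a Kähler manifold, the cubic form `⟨∇_w h, J k⟩` is symmetric in
`h` and `k`. -/
theorem inner_frameDeriv_J_comm (hJ : IsKahler J) (hF : ContMDiff I I' ∞ F)
    (hanti : IsAntiInvariant I I' F J) (hD : ∀ p, D (F p) = rangeAt I I' F p)
    (hU : IsOpen U) (hX : ∀ i, ContMDiffOn I' I'.tangent ∞ (T% (X i)) U)
    (hon : ∀ z ∈ U, Orthonormal ℝ (fun i ↦ X i z) ∧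
      Submodule.span ℝ (Set.range fun i ↦ X i z) = D z) {p : M} (hp : F p ∈ U)
    (x : TangentSpace I p) {h k : TangentSpace I' (F p)} (hh : h ∈ D (F p)) (hk : k ∈ D (F p)) :
    inner ℝ (frameDeriv X (F p) (mfderiv I I' F p x) h) (J (F p) k) =
      inner ℝ (frameDeriv X (F p) (mfderiv I I' F p x) k) (J (F p) h) := by
  let Y (h : TangentSpace I' (F p)) : Π z : N, TangentSpace I' z :=
    fun z ↦ ∑ i, (inner ℝ (X i (F p)) h : ℝ) • X i z
  have hY (h) : ContMDiffOn I' I'.tangent ∞ (T% (Y h)) U :=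
    .sum_section fun i _ ↦ ContMDiffOn.smul_section contMDiffOn_const (hX i)
  have hYD (h) (z) (hz : z ∈ U) : Y h z ∈ D z :=
    Submodule.sum_mem _ fun i _ ↦ Submodule.smul_mem _ _
      ((hon z hz).2 ▸ Submodule.subset_span ⟨i, rfl⟩)
  have hYp (h) (hh : h ∈ D (F p)) : Y h (F p) = h :=
    sum_inner_smul_of_orthonormal_of_span (hon _ hp).1 (by rwa [(hon _ hp).2])
  have hdY (h w) : leviCivita I' N (Y h) (F p) w = frameDeriv X (F p) w h :=
    leviCivita_sum_const_smul (fun i ↦ (hX i).mdiffAt_section hU hp) w h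
  have hJY := hJ.contMDiffOn_apply (hY k)
  have hFd : MDifferentiableAt I I' F p := hF.mdifferentiable (by simp) p
  have d1 := (hY h).mdiffAt_section hU hp
  have d2 := hJY.mdiffAt_section hU hp
  -- Differentiate `⟨Y h, J (Y k)⟩` along `F`. It vanishes at the points `F q`, where `D` is `range
  -- F_*`; elsewhere in `U` anti-invariance of `D` is not known, so the direction has to be some
  -- `F_* x`.
  have h1 := mvfderiv_inner_along (I := I) (MDiffAlongAt.comp hFd d1) (MDiffAlongAt.comp hFd d2) x
  rw [pullbackCov_comp hFd d1, pullbackCov_comp hFd d2, hJ.parallel U hU _ (hY k) _ hp, hdY, hdY,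
    hYp h hh, hYp k hk, hJ.inner_apply_right h] at h1
  have h0 : (fun q ↦ inner ℝ (Y h (F q)) (J (F q) (Y k (F q)))) =ᶠ[𝓝 p] fun _ ↦ (0 : ℝ) := by
    filter_upwards [hFd.continuousAt (hU.mem_nhds hp)] with q hq
    have h2 := hYD k _ hq
    have h3 := hYD h _ hq
    rw [hD] at h2 h3
    exact hanti q (Submodule.mem_map_of_mem h2) _ h3
  have h2 : mvfderiv I (fun q ↦ inner ℝ (Y h (F q)) (J (F q) (Y k (F q)))) p x = 0 := by
    have h3 := h0.mfderiv_eq (I := I) (I' := 𝓘(ℝ, ℝ))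
    rw [mfderiv_const] at h3
    exact congrArg (fun A : TangentSpace I p →L[ℝ] ℝ ↦ A x) h3
  rw [h2] at h1
  rw [real_inner_comm (J (F p) h)]
  linarith

variable [I'.Boundaryless] in
omit [FiniteDimensional ℝ E] in
/-- The pullback connection preserves sections of `range F_*`. -/
theorem pullbackCov_mem_rangeAt (hJ : IsKahler J) (hF : ContMDiff I I' ∞ F)
    (hLag : IsLagrangian I I' F J) (hrank : ∀ p : M, 1 < finrank ℝ (rangeAt I I' F p))
    (hD : IsRangeDistribution I I' F D W) (hperp : IsTotallyGeodesicOn (fun y ↦ (D y)ᗮ) W)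
    (hg : ContMDiff I' 𝓘(ℝ, ℝ) ∞ g) (hC : ClairautRelation D W (fun y ↦ Real.exp (g y)))
    {p : M} {σ : Π q : M, TangentSpace I' (F q)} (hσ : MDiffAlongAt I I' F σ p)
    (hσF : ∀ q, σ q ∈ rangeAt I I' F q) (x : TangentSpace I p) :
    pullbackCov I I' F σ p x ∈ rangeAt I I' F p := by
  obtain ⟨U, hU, hp, hUW, r, X₀, hX₀, hspan⟩ :=
    hD.smooth (F p) (hD.range_subset (mem_range_self p))
  obtain ⟨X, hX, hX'⟩ := exists_orthonormal_frame hX₀ fun z hz ↦ (hspan z hz).1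
  have hon (z) (hz : z ∈ U) : Orthonormal ℝ (fun i ↦ X i z) ∧
      Submodule.span ℝ (Set.range fun i ↦ X i z) = D z :=
    ⟨(hX' z hz).1, (hX' z hz).2.trans (hspan z hz).2⟩
  have hrg := hD.eq_rangeAt p
  have hcov {σ : Π q : M, TangentSpace I' (F q)} (hσ : MDiffAlongAt I I' F σ p)
      (hσF : ∀ q, σ q ∈ rangeAt I I' F q) (x : TangentSpace I p) :
      pullbackCov I I' F σ p x - frameDeriv X (F p) (mfderiv I I' F p x) (σ p) ∈ D (F p) :=
    pullbackCov_sub_frameDeriv_mem hU hX hon hp rfl hσ (fun q ↦ by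
      rw [hD.eq_rangeAt]
      exact hσF q) x
  -- With `h = F_* a` and `k = F_* b`, both terms are values of the second fundamental form of `F`
  -- modulo `D`. The symmetry comes from `F`; integrability of `D` on `W` is not needed.
  have hsymm (h) (hh : h ∈ D (F p)) (k) (hk : k ∈ D (F p)) :
      frameDeriv X (F p) h k - frameDeriv X (F p) k h ∈ D (F p) := by
    rw [hrg] at hh hk
    obtain ⟨a, rfl⟩ := hh
    obtain ⟨b, rfl⟩ := hk
    have h1 := hcov (mdiffAlongAt_mfderiv hF (mdifferentiableAt_extend I E b))
      (fun q ↦ ⟨_, rfl⟩) a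
    have h2 := hcov (mdiffAlongAt_mfderiv hF (mdifferentiableAt_extend I E a))
      (fun q ↦ ⟨_, rfl⟩) b
    rw [pullbackCov_mfderiv_extend_symm hF a b] at h1
    have h3 := Submodule.sub_mem _ h2 h1
    rw [sub_sub_sub_cancel_left] at h3
    simp only [extend_apply_self] at h3
    exact h3
  have hmem : frameDeriv X (F p) (mfderiv I I' F p x) (σ p) ∈ D (F p) := by
    refine mem_of_umbilical_of_lagrangian (K := D (F p)) (by rw [hrg]; exact hrank p)
      (J := (J (F p)).toLinearMap) (by rw [hrg]; exact hLag.1 p) (by rw [hrg]; exact hLag.2 p)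
      (B := frameDeriv X (F p)) (γ := mvfderiv I' g (F p)) (frameDeriv_add_left (F p))
      (frameDeriv_add_right (F p))
      (fun h hh V hV ↦ inner_frameDeriv_of_clairaut hU hX hon hp hUW hperp hg hC h V hh hV)
      hsymm (fun w hw h hh k hk ↦ ?_) (by rw [hrg]; exact ⟨x, rfl⟩) (by rw [hrg]; exact hσF p)
    rw [hrg] at hw
    obtain ⟨a, rfl⟩ := hw
    exact inner_frameDeriv_J_comm hJ hF hLag.1 hD.eq_rangeAt hU hX hon hp a hh hk
  have h1 := Submodule.add_mem _ (hcov hσ hσF x) hmem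
  rw [sub_add_cancel, hrg] at h1
  exact h1

end Lagrangian

theorem mainTheorem11
    {m n : ℕ}
    {M : Type*} [TopologicalSpace M] [T2Space M] [ChartedSpace (EuclideanSpace ℝ (Fin m)) M]
    [IsManifold (𝓡 m) ∞ M]
    [RiemannianBundle (fun x : M ↦ TangentSpace (𝓡 m) x)]
    [IsContMDiffRiemannianBundle (𝓡 m) ∞ (EuclideanSpace ℝ (Fin m))
      (fun x : M ↦ TangentSpace (𝓡 m) x)]
    {N : Type*} [TopologicalSpace N] [T2Space N] [ChartedSpace (EuclideanSpace ℝ (Fin n)) N]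
    [IsManifold (𝓡 n) ∞ N]
    [RiemannianBundle (fun y : N ↦ TangentSpace (𝓡 n) y)]
    [IsContMDiffRiemannianBundle (𝓡 n) ∞ (EuclideanSpace ℝ (Fin n))
      (fun y : N ↦ TangentSpace (𝓡 n) y)]
    (J : Π y : N, TangentSpace (𝓡 n) y →L[ℝ] TangentSpace (𝓡 n) y) (hJ : IsKahler J)
    (F : M → N) (hF : IsRiemannianMap (𝓡 m) (𝓡 n) F)
    (hLag : IsLagrangian (𝓡 m) (𝓡 n) F J)
    (hrank : ∀ p : M, 1 < Module.finrank ℝ (rangeAt (𝓡 m) (𝓡 n) F p))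
    (D : Π y : N, Submodule ℝ (TangentSpace (𝓡 n) y)) (W : Set N)
    (hD : IsRangeDistribution (𝓡 m) (𝓡 n) F D W)
    (hperp : IsTotallyGeodesicOn (fun y ↦ (D y)ᗮ) W)
    (g : N → ℝ) (hg : ContMDiff (𝓡 n) 𝓘(ℝ, ℝ) ∞ g)
    (hClairaut : ClairautRelation D W (fun y ↦ Real.exp (g y))) :
    IsRangeMinimal (𝓡 m) (𝓡 n) F ∧ IsRangeTotallyGeodesic (𝓡 m) (𝓡 n) F := by
  refine ⟨fun p ↦ ?_, fun U hU X Y hX hY p hp ↦ ?_⟩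
  -- Each summand of the trace vanishes separately, being the normal part of a vector of `range
  -- F_*`.
  · rw [rangeMeanCurvature, Finset.sum_eq_zero, smul_zero]
    intro j _
    rw [rangeSecondFundamentalForm, Submodule.starProjection_apply_eq_zero_iff,
      Submodule.orthogonal_orthogonal]
    exact pullbackCov_mem_rangeAt hJ hF.smooth hLag hrank hD hperp hg hClairaut
      (mdiffAlongAt_mfderiv hF.smooth (mdifferentiableAt_extend _ _ _)) (fun q ↦ ⟨_, rfl⟩) _
  · exact pullbackCov_mem_rangeAt hJ hF.smooth hLag hrank hD hperp hg hClairaut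
      (mdiffAlongAt_mfderiv hF.smooth ((hY.contMDiffAt (hU.mem_nhds hp)).mdifferentiableAt
        (by simp))) (fun q ↦ ⟨_, rfl⟩) _
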